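/- **Theorem (PUC-Logic is decidable).** Both derivability and validity of PUC-Logic formulas are decidable: there are algorithms that decide (i) for a given formula $\alpha\in F_n$ whether it is a theorem, $\vdash\alpha$, of the natural deduction system PUC-ND; (ii) for a given $\alpha\in F_n$ whether it is an n-tautology; (iii) for a given $\alpha\in F_w$ whether it is a w-tautology. (Formulas are given by their numbers in a fixed injective effective numbering.) *Formulas.* There are countably many proposition symbols $p_i$, neighbourhood variables $N,M,P,\dots$ and world variables $u,\dots$. Neighbourhood labels are $\circledast$ (universal), $\circledcirc$ (existential) and the neighbourhood variables; world labels are $\ast$ (universal), $\bullet$ (existential) and the world variables. The sets $F_n$, $F_w$ of formulas are the least with: $p_i,\top_n,\bot_n\in F_n$; $\top_w,\bot_w\in F_w$; $\uparrow\! N,\ \downarrow\! N\in F_w$ for each neighbourhood variable $N$; each of $F_n$, $F_w$ is closed under $\neg,\wedge,\vee,\to$; if $\alpha\in F_n$ and $\phi$ is a world label, then $\alpha^{\phi}\in F_w$; if $\alpha\in F_w$ and $\phi$ is a neighbourhood label, then $\alpha^{\phi}\in F_n$. *Semantics.* A frame is a nonempty set $W$ of worlds with a function $\$$ assigning to each world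 a set of subsets of $W$ totally ordered by inclusion, and a set $V(p)\subseteq W$ for each proposition symbol. A model adds a reference world $\chi\in W$; a template adds to a model a set $S\in\$(\chi)$. An assignment $\sigma$ maps world variables to worlds and neighbourhood variables to nonempty subsets of $W$. Formulas of $F_n$ are evaluated at models (written $\chi$), those of $F_w$ at templates (written $(\chi,S)$); connectives, $\top$ and $\bot$ are classical, and $\chi\models p$ iff $\chi\in V(p)$; $\chi\models\alpha^{\circledast}$ (resp. $\alpha^{\circledcirc}$) iff $(\chi,S)\models\alpha$ for all (resp. some) $S\in\$(\chi)$; $\chi\models\alpha^{N}$ iff $\sigma(N)\in\$(\chi)$ and $(\chi,\sigma(N))\models\alpha$; $(\chi,S)\models\alpha^{\ast}$ (resp. $\alpha^{\bullet}$) iff $w\models\alpha$ for all (resp. some) $w\in S$; $(\chi,S)\models\alpha^{u}$ iff $\sigma(u)\in S$ and $\sigma(u)\models\alpha$; $(\chi,S)\models\ \uparrow\! M$ (resp. $\downarrow\! M$) iff $\sigma(M)\in\$(\chi)$ and $\sigma(M)\subseteq S$ (resp. $S\subseteq\sigma(M)$). An n-tautology (w-tautology) is a formula of $F_n$ ($F_w$)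 true in every model (template) under every assignment. *The system PUC-ND.* A context $\Delta$ is a stack (finite sequence, top on the right) of labels; $\alpha$ fits into $\Delta$ if labelling $\alpha$ successively by the labels of $\Delta$, from the top down, yields a formula of $F_n$. A derivation is a tree of judgements $\Delta:\alpha$ with $\alpha$ fitting into $\Delta$; all displayed formulas must fit. Brackets mark discharged hypotheses; $\bot,\top$ stand for the constants of the kind that fits; $\neg\alpha$ is interchangeable with $\alpha\to\bot$ in the rules for $\to$. The rules are: (1,2) $\Delta:\alpha\wedge\beta\ /\ \Delta:\alpha$ and $/\ \Delta:\beta$; (3) $\Delta:\alpha,\ \Delta:\beta\ /\ \Delta:\alpha\wedge\beta$; in (1–3) $\Delta$ has no $\circledcirc,\bullet$. (4,6) $\Delta:\alpha\ /\ \Delta:\alpha\vee\beta$ and $\Delta:\beta\ /\ \Delta:\alpha\vee\beta$; (5) $\Delta:\alpha\vee\beta,\ [\Delta:\alpha]\dots\Theta:\gamma,\ [\Delta:\beta]\dots\Theta:\gamma\ /\ \Theta:\gamma$; in (4–6) $\Delta$ has no $\circledast,\ast$. (7) $[\Delta:\neg\alpha]\dots\Delta:\bot\ /\ \Delta:\alpha$.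 (8) $\Delta:\bot\ /\ \Delta:\alpha$. (9) $\Delta:\bot\ /\ \bot_n$ in the empty context, if $\Delta$ is nonempty and has no $\circledast$. (10) From the hypothesis $\Delta:\alpha$ infer $\Delta:\alpha$. (11) $[\Delta:\alpha]\dots\Delta:\beta\ /\ \Delta:\alpha\to\beta$. (12) $\Delta:\alpha,\ \Delta:\alpha\to\beta\ /\ \Delta:\beta$, if $\Delta$ has no $\circledcirc,\bullet$. (13,14) $\Delta:\alpha^{\phi}\ /\ \Delta,\phi:\alpha$ and conversely. (15) $\Delta,u:\alpha\ /\ \Delta,\ast:\alpha$, if $u$ occurs in no open hypothesis on which the premise depends nor in the context of one. (16) $\Delta,\ast:\alpha\ /\ \Delta,u:\alpha$, if $u$ does not occur in $\alpha,\Delta$. (17) $\Delta,u:\alpha\ /\ \Delta,\bullet:\alpha$. (18) $\Delta,\bullet:\alpha,\ [\Delta,u:\alpha]\dots\Theta:\beta\ /\ \Theta:\beta$, if $u$ does not occur in $\alpha,\Delta,\Theta$ or in any remaining open hypothesis or its context. (19) $\Delta,N:\alpha,\ \Delta,\circledcirc:\beta\ /\ \Delta,\circledcirc:\alpha$. (20)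 $\Delta,\circledcirc:\alpha,\ [\Delta,N:\alpha]\dots\Theta:\beta\ /\ \Theta:\beta$, if $N$ does not occur in $\alpha,\Delta,\Theta$ or in any remaining open hypothesis or its context. (21) $\Delta,N:\alpha\ /\ \Delta,\circledast:\alpha$, if $N$ occurs in no open hypothesis on which the premise depends nor in the context of one. (22) $\Delta,\circledast:\alpha,\ \Delta,N:\beta\ /\ \Delta,N:\alpha$. (23) $\Delta,N:\alpha^{\bullet},\ \Delta,M:\uparrow\! N\ /\ \Delta,M:\alpha^{\bullet}$. (24) $\Delta,N:\alpha^{\ast},\ \Delta,M:\downarrow\! N\ /\ \Delta,M:\alpha^{\ast}$. (25) $\Delta,N:\uparrow\! M,\ \Delta,M:\uparrow\! P\ /\ \Delta,N:\uparrow\! P$. (26) The same with $\downarrow$. (27) $[\Delta,N:\uparrow\! M]\dots\Theta:\alpha,\ [\Delta,M:\uparrow\! N]\dots\Theta:\alpha\ /\ \Theta:\alpha$. (28) The same with $\downarrow$. (29) $[\Delta,M:\uparrow\! N]\dots\Theta:\alpha,\ [\Delta,M:\downarrow\! N]\dots\Theta:\alpha\ /\ \Theta:\alpha$. (30) $\Delta:\top$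 without premises, if $\Delta$ has no $\circledcirc$. A formula $\alpha\in F_n$ is a theorem, $\vdash\alpha$, if it has a derivation in the empty context without open hypotheses. -/

import Mathlib

universe u

namespace PUC

/-- The two kinds of formulas: neighbourhood formulas `F_n` (evaluated at models) and
world formulas `F_w` (evaluated at templates). -/
inductive Kind : Type
  | n
  | w

/-- Neighbourhood labels: `⊛` (`all`), `⊚` (`ex`) and the neighbourhood variables. -/
inductive NLabel : Type
  | all : NLabel
  | ex : NLabel
  | var (N : ℕ) : NLabel

/-- World labels: `∗` (`all`), `•` (`ex`) and the world variables. -/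
inductive WLabel : Type
  | all : WLabel
  | ex : WLabel
  | var (z : ℕ) : WLabel

/-- Well-formed formulas: `Fml .n` is `F_n` and `Fml .w` is `F_w`.
`incl N` is the constant saying that `N` is contained in the reference neighbourhood,
`cont N` the one saying that the reference neighbourhood is contained in `N`.
A world label turns a formula of `F_n` into one of `F_w` and
a neighbourhood label turns a formula of `F_w` into one of `F_n`. -/
inductive Fml : Kind → Type
  | atom (p : ℕ) : Fml .n
  | incl (N : ℕ) : Fml .w
  | cont (N : ℕ) : Fml .w
  | top {s : Kind} : Fml s
  | bot {s : Kind} : Fml s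
  | neg {s : Kind} (α : Fml s) : Fml s
  | and {s : Kind} (α β : Fml s) : Fml s
  | or {s : Kind} (α β : Fml s) : Fml s
  | imp {s : Kind} (α β : Fml s) : Fml s
  | byW (φ : WLabel) (α : Fml .n) : Fml .w
  | byN (φ : NLabel) (α : Fml .w) : Fml .n

/-! ### Goedel numbering -/

def NLabel.code : NLabel → ℕ
  | .all => 0
  | .ex => 1
  | .var N => N + 2

def WLabel.code : WLabel → ℕ
  | .all => 0
  | .ex => 1
  | .var z => z + 2

/-- Goedel number of a formula. -/
def Fml.code : {s : Kind} → Fml s → ℕ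
  | _, .atom p => Nat.pair 0 p
  | _, .incl N => Nat.pair 1 N
  | _, .cont N => Nat.pair 2 N
  | _, .top => Nat.pair 3 0
  | _, .bot => Nat.pair 4 0
  | _, .neg α => Nat.pair 5 α.code
  | _, .and α β => Nat.pair 6 (Nat.pair α.code β.code)
  | _, .or α β => Nat.pair 7 (Nat.pair α.code β.code)
  | _, .imp α β => Nat.pair 8 (Nat.pair α.code β.code)
  | _, .byW φ α => Nat.pair 9 (Nat.pair φ.code α.code)
  | _, .byN φ α => Nat.pair 10 (Nat.pair φ.code α.code)

theorem NLabel.code_injective : Function.Injective NLabel.code := by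
  intro a b h
  cases a <;> cases b <;> simp_all [NLabel.code]

theorem WLabel.code_injective : Function.Injective WLabel.code := by
  intro a b h
  cases a <;> cases b <;> simp_all [WLabel.code]

theorem Fml.code_injective {s : Kind} : Function.Injective (Fml.code (s := s)) := by
  intro a
  induction a with
  | byW φ α ih =>
    intro b h
    cases b <;> simp [Fml.code, Nat.pair_eq_pair] at h
    exact congrArg₂ _ (WLabel.code_injective h.1) (ih h.2)
  | byN φ α ih =>
    intro b h
    cases b <;> simp [Fml.code, Nat.pair_eq_pair] at h
    exact congrArg₂ _ (NLabel.code_injective h.1) (ih h.2)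
  | neg α ih =>
    intro b h
    cases b <;> simp [Fml.code, Nat.pair_eq_pair] at h
    exact congrArg _ (ih h)
  | and α β ih₁ ih₂ =>
    intro b h
    cases b <;> simp [Fml.code, Nat.pair_eq_pair] at h
    exact congrArg₂ _ (ih₁ h.1) (ih₂ h.2)
  | or α β ih₁ ih₂ =>
    intro b h
    cases b <;> simp [Fml.code, Nat.pair_eq_pair] at h
    exact congrArg₂ _ (ih₁ h.1) (ih₂ h.2)
  | imp α β ih₁ ih₂ =>
    intro b h
    cases b <;> simp [Fml.code, Nat.pair_eq_pair] at h
    exact congrArg₂ _ (ih₁ h.1) (ih₂ h.2)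
  | _ =>
    intro b h
    cases b <;> simp_all [Fml.code, Nat.pair_eq_pair]

/-! ### Semantics -/

/-- A frame on the set of worlds `W`: `nest` is the nesting function `$` and
`val` assigns a set of worlds to each proposition symbol. -/
structure Frame (W : Type u) where
  nest : W → Set (Set W)
  nested : ∀ χ, ∀ S ∈ nest χ, ∀ T ∈ nest χ, S ⊆ T ∨ T ⊆ S
  val : ℕ → Set W

/-- A variable assignment. -/
structure Assignment (W : Type u) where
  world : ℕ → W
  nbhd : ℕ → Set W
  nbhd_nonempty : ∀ N, (nbhd N).Nonempty

/-- The templates over a frame: a reference world with a neighbourhood from its system. -/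
structure Template {W : Type u} (F : Frame W) where
  ref : W
  nbhd : Set W
  mem : nbhd ∈ F.nest ref

/-- The structures over a frame at which formulas of a given kind are evaluated:
models (given by their reference world) for `F_n`, templates for `F_w`. -/
abbrev Struc {W : Type u} (F : Frame W) : Kind → Type u
  | .n => W
  | .w => Template F

/-- Satisfaction. A formula labelled by a neighbourhood (world) variable requires that the
denotation of the variable is a neighbourhood of the reference world (a world of the
reference neighbourhood). -/
def Sat {W : Type u} (F : Frame W) (σ : Assignment W) : {s : Kind} → Fml s → Struc F s → Prop
  | _, .atom p, χ => χ ∈ F.val p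
  | _, .incl M, T => σ.nbhd M ∈ F.nest T.ref ∧ σ.nbhd M ⊆ T.nbhd
  | _, .cont M, T => σ.nbhd M ∈ F.nest T.ref ∧ T.nbhd ⊆ σ.nbhd M
  | _, .top, _ => True
  | _, .bot, _ => False
  | _, .neg α, x => ¬ Sat F σ α x
  | _, .and α β, x => Sat F σ α x ∧ Sat F σ β x
  | _, .or α β, x => Sat F σ α x ∨ Sat F σ β x
  | _, .imp α β, x => ¬ Sat F σ α x ∨ Sat F σ β x
  | _, .byN .all α, χ => ∀ (N : Set W) (h : N ∈ F.nest χ), Sat F σ α ⟨χ, N, h⟩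
  | _, .byN .ex α, χ => ∃ (N : Set W) (h : N ∈ F.nest χ), Sat F σ α ⟨χ, N, h⟩
  | _, .byN (.var X) α, χ => ∃ h : σ.nbhd X ∈ F.nest χ, Sat F σ α ⟨χ, σ.nbhd X, h⟩
  | _, .byW .all α, T => ∀ v ∈ T.nbhd, Sat F σ α v
  | _, .byW .ex α, T => ∃ v ∈ T.nbhd, Sat F σ α v
  | _, .byW (.var z) α, T => σ.world z ∈ T.nbhd ∧ Sat F σ α (σ.world z)

/-- Validity: truth under every assignment in every model (for `F_n`), respectively in every
template (for `F_w`); these are the n-tautologies and the w-tautologies. -/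
def Valid {s : Kind} (φ : Fml s) : Prop :=
  ∀ (W : Type u) (F : Frame W) (σ : Assignment W) (x : Struc F s), Sat F σ φ x

/-! ### The natural deduction system PUC-ND -/

/-- Contexts, i.e. stacks of labels. `Ctx s` consists of the contexts `Δ` into which the
formulas of kind `s` fit, that is, for which labelling a formula of kind `s` by the labels of `Δ`
(top of the stack first) yields a formula of `F_n`; see `Ctx.close`.
The last argument of `addN` and `addW` is the top of the stack. -/
inductive Ctx : Kind → Type
  | nil : Ctx .n
  | addN (Δ : Ctx .n) (φ : NLabel) : Ctx .w
  | addW (Δ : Ctx .w) (φ : WLabel) : Ctx .n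

/-- The formula of `F_n` obtained by moving the context into the formula. -/
def Ctx.close : {s : Kind} → Ctx s → Fml s → Fml .n
  | _, .nil, α => α
  | _, .addN Δ φ, α => Δ.close (.byN φ α)
  | _, .addW Δ φ, α => Δ.close (.byW φ α)

/-- The context is empty. -/
def Ctx.IsNil : {s : Kind} → Ctx s → Prop
  | _, .nil => True
  | _, .addN _ _ => False
  | _, .addW _ _ => False

/-- `⊛` occurs in the context. -/
def Ctx.HasNAll : {s : Kind} → Ctx s → Prop
  | _, .nil => False
  | _, .addN Δ φ => φ = .all ∨ Δ.HasNAll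
  | _, .addW Δ _ => Δ.HasNAll

/-- `⊚` occurs in the context. -/
def Ctx.HasNEx : {s : Kind} → Ctx s → Prop
  | _, .nil => False
  | _, .addN Δ φ => φ = .ex ∨ Δ.HasNEx
  | _, .addW Δ _ => Δ.HasNEx

/-- A universal quantifier (`⊛` or `∗`) occurs in the context. -/
def Ctx.HasUniv : {s : Kind} → Ctx s → Prop
  | _, .nil => False
  | _, .addN Δ φ => φ = .all ∨ Δ.HasUniv
  | _, .addW Δ φ => φ = .all ∨ Δ.HasUniv

/-- An existential quantifier (`⊚` or `•`) occurs in the context. -/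
def Ctx.HasExis : {s : Kind} → Ctx s → Prop
  | _, .nil => False
  | _, .addN Δ φ => φ = .ex ∨ Δ.HasExis
  | _, .addW Δ φ => φ = .ex ∨ Δ.HasExis

/-- The neighbourhood variable `N` occurs in the context. -/
def Ctx.OccN (N : ℕ) : {s : Kind} → Ctx s → Prop
  | _, .nil => False
  | _, .addN Δ φ => φ = .var N ∨ Δ.OccN N
  | _, .addW Δ _ => Δ.OccN N

/-- The world variable `z` occurs in the context. -/
def Ctx.OccW (z : ℕ) : {s : Kind} → Ctx s → Prop
  | _, .nil => False
  | _, .addN Δ _ => Δ.OccW z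
  | _, .addW Δ φ => φ = .var z ∨ Δ.OccW z

/-- The neighbourhood variable `N` occurs in the formula. -/
def Fml.OccN (N : ℕ) : {s : Kind} → Fml s → Prop
  | _, .atom _ => False
  | _, .incl M => M = N
  | _, .cont M => M = N
  | _, .top => False
  | _, .bot => False
  | _, .neg α => α.OccN N
  | _, .and α β => α.OccN N ∨ β.OccN N
  | _, .or α β => α.OccN N ∨ β.OccN N
  | _, .imp α β => α.OccN N ∨ β.OccN N
  | _, .byW _ α => α.OccN N
  | _, .byN φ α => φ = .var N ∨ α.OccN N

/-- The world variable `z` occurs in the formula. -/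
def Fml.OccW (z : ℕ) : {s : Kind} → Fml s → Prop
  | _, .atom _ => False
  | _, .incl _ => False
  | _, .cont _ => False
  | _, .top => False
  | _, .bot => False
  | _, .neg α => α.OccW z
  | _, .and α β => α.OccW z ∨ β.OccW z
  | _, .or α β => α.OccW z ∨ β.OccW z
  | _, .imp α β => α.OccW z ∨ β.OccW z
  | _, .byW φ α => φ = .var z ∨ α.OccW z
  | _, .byN _ α => α.OccW z

/-- A hypothesis: a formula placed in a context into which it fits. -/
structure Hyp where
  kind : Kind
  ctx : Ctx kind
  fml : Fml kind

/-- A formula in a context, as a hypothesis. -/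
def hyp {s : Kind} (Δ : Ctx s) (α : Fml s) : Hyp := ⟨s, Δ, α⟩

/-- The neighbourhood variable `N` occurs neither in the hypotheses nor in their contexts. -/
def FreshN (N : ℕ) (H : Set Hyp) : Prop :=
  ∀ h ∈ H, ¬ h.fml.OccN N ∧ ¬ h.ctx.OccN N

/-- The world variable `z` occurs neither in the hypotheses nor in their contexts. -/
def FreshW (z : ℕ) (H : Set Hyp) : Prop :=
  ∀ h ∈ H, ¬ h.fml.OccW z ∧ ¬ h.ctx.OccW z

/-- `Deriv H Δ α`: there is a derivation in PUC-ND with conclusion `α` in the context `Δ` whose set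
of open hypotheses is `H`. The requirement that formulas fit into their contexts is built into
the types. As usual for this system, `¬ α` is interchangeable with `α → ⊥`: the constructors
`neg_intro` and `neg_elim` are implication introduction and elimination for `¬ α` read in this
way. -/
inductive Deriv : Set Hyp → {s : Kind} → Ctx s → Fml s → Prop
  | and_elim_left {s : Kind} {H : Set Hyp} {Δ : Ctx s} {α β : Fml s} :
      ¬ Δ.HasExis → Deriv H Δ (.and α β) → Deriv H Δ α
  | and_elim_right {s : Kind} {H : Set Hyp} {Δ : Ctx s} {α β : Fml s} :
      ¬ Δ.HasExis → Deriv H Δ (.and α β) → Deriv H Δ β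
  | and_intro {s : Kind} {H₁ H₂ : Set Hyp} {Δ : Ctx s} {α β : Fml s} :
      ¬ Δ.HasExis → Deriv H₁ Δ α → Deriv H₂ Δ β → Deriv (H₁ ∪ H₂) Δ (.and α β)
  | or_intro_left {s : Kind} {H : Set Hyp} {Δ : Ctx s} {α β : Fml s} :
      ¬ Δ.HasUniv → Deriv H Δ α → Deriv H Δ (.or α β)
  | or_elim {s t : Kind} {H₁ H₂ H₃ : Set Hyp} {Δ : Ctx s} {α β : Fml s} {Θ : Ctx t} {γ : Fml t} :
      ¬ Δ.HasUniv → Deriv H₁ Δ (.or α β) → Deriv H₂ Θ γ → Deriv H₃ Θ γ →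
      Deriv (H₁ ∪ (H₂ \ {hyp Δ α}) ∪ (H₃ \ {hyp Δ β})) Θ γ
  | or_intro_right {s : Kind} {H : Set Hyp} {Δ : Ctx s} {α β : Fml s} :
      ¬ Δ.HasUniv → Deriv H Δ β → Deriv H Δ (.or α β)
  | bot_classical {s : Kind} {H : Set Hyp} {Δ : Ctx s} {α : Fml s} :
      Deriv H Δ .bot → Deriv (H \ {hyp Δ (.neg α)}) Δ α
  | bot_intuitionistic {s : Kind} {H : Set Hyp} {Δ : Ctx s} {α : Fml s} :
      Deriv H Δ .bot → Deriv H Δ α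
  | absurd_expansion {s : Kind} {H : Set Hyp} {Δ : Ctx s} :
      ¬ Δ.HasNAll → ¬ Δ.IsNil → Deriv H Δ .bot → Deriv H .nil .bot
  | hypothesis_injection {s : Kind} {Δ : Ctx s} {α : Fml s} :
      Deriv {hyp Δ α} Δ α
  | imp_intro {s : Kind} {H : Set Hyp} {Δ : Ctx s} {α β : Fml s} :
      Deriv H Δ β → Deriv (H \ {hyp Δ α}) Δ (.imp α β)
  | neg_intro {s : Kind} {H : Set Hyp} {Δ : Ctx s} {α : Fml s} :
      Deriv H Δ .bot → Deriv (H \ {hyp Δ α}) Δ (.neg α)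
  | imp_elim {s : Kind} {H₁ H₂ : Set Hyp} {Δ : Ctx s} {α β : Fml s} :
      ¬ Δ.HasExis → Deriv H₁ Δ α → Deriv H₂ Δ (.imp α β) → Deriv (H₁ ∪ H₂) Δ β
  | neg_elim {s : Kind} {H₁ H₂ : Set Hyp} {Δ : Ctx s} {α : Fml s} :
      ¬ Δ.HasExis → Deriv H₁ Δ α → Deriv H₂ Δ (.neg α) → Deriv (H₁ ∪ H₂) Δ .bot
  | context_intro_n {H : Set Hyp} {Δ : Ctx .n} {φ : NLabel} {α : Fml .w} :
      Deriv H Δ (.byN φ α) → Deriv H (.addN Δ φ) α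
  | context_intro_w {H : Set Hyp} {Δ : Ctx .w} {φ : WLabel} {α : Fml .n} :
      Deriv H Δ (.byW φ α) → Deriv H (.addW Δ φ) α
  | context_elim_n {H : Set Hyp} {Δ : Ctx .n} {φ : NLabel} {α : Fml .w} :
      Deriv H (.addN Δ φ) α → Deriv H Δ (.byN φ α)
  | context_elim_w {H : Set Hyp} {Δ : Ctx .w} {φ : WLabel} {α : Fml .n} :
      Deriv H (.addW Δ φ) α → Deriv H Δ (.byW φ α)
  | world_univ_intro {H : Set Hyp} {Δ : Ctx .w} {z : ℕ} {α : Fml .n} :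
      FreshW z H → Deriv H (.addW Δ (.var z)) α → Deriv H (.addW Δ .all) α
  | world_univ_elim {H : Set Hyp} {Δ : Ctx .w} {z : ℕ} {α : Fml .n} :
      ¬ α.OccW z → ¬ Δ.OccW z → Deriv H (.addW Δ .all) α → Deriv H (.addW Δ (.var z)) α
  | world_exis_intro {H : Set Hyp} {Δ : Ctx .w} {z : ℕ} {α : Fml .n} :
      Deriv H (.addW Δ (.var z)) α → Deriv H (.addW Δ .ex) α
  | world_exis_elim {t : Kind} {H₁ H₂ : Set Hyp} {Δ : Ctx .w} {z : ℕ} {α : Fml .n}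
      {Θ : Ctx t} {β : Fml t} :
      ¬ α.OccW z → ¬ Δ.OccW z → ¬ Θ.OccW z →
      FreshW z (H₁ ∪ (H₂ \ {hyp (.addW Δ (.var z)) α})) →
      Deriv H₁ (.addW Δ .ex) α → Deriv H₂ Θ β →
      Deriv (H₁ ∪ (H₂ \ {hyp (.addW Δ (.var z)) α})) Θ β
  | nbhd_exis_intro {H₁ H₂ : Set Hyp} {Δ : Ctx .n} {N : ℕ} {α β : Fml .w} :
      Deriv H₁ (.addN Δ (.var N)) α → Deriv H₂ (.addN Δ .ex) β →
      Deriv (H₁ ∪ H₂) (.addN Δ .ex) α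
  | nbhd_exis_elim {t : Kind} {H₁ H₂ : Set Hyp} {Δ : Ctx .n} {N : ℕ} {α : Fml .w}
      {Θ : Ctx t} {β : Fml t} :
      ¬ α.OccN N → ¬ Δ.OccN N → ¬ Θ.OccN N →
      FreshN N (H₁ ∪ (H₂ \ {hyp (.addN Δ (.var N)) α})) →
      Deriv H₁ (.addN Δ .ex) α → Deriv H₂ Θ β →
      Deriv (H₁ ∪ (H₂ \ {hyp (.addN Δ (.var N)) α})) Θ β
  | nbhd_univ_intro {H : Set Hyp} {Δ : Ctx .n} {N : ℕ} {α : Fml .w} :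
      FreshN N H → Deriv H (.addN Δ (.var N)) α → Deriv H (.addN Δ .all) α
  | nbhd_univ_wildcard {H₁ H₂ : Set Hyp} {Δ : Ctx .n} {N : ℕ} {α β : Fml .w} :
      Deriv H₁ (.addN Δ .all) α → Deriv H₂ (.addN Δ (.var N)) β →
      Deriv (H₁ ∪ H₂) (.addN Δ (.var N)) α
  | world_exis_propagation {H₁ H₂ : Set Hyp} {Δ : Ctx .n} {N M : ℕ} {α : Fml .n} :
      Deriv H₁ (.addN Δ (.var N)) (.byW .ex α) → Deriv H₂ (.addN Δ (.var M)) (.incl N) →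
      Deriv (H₁ ∪ H₂) (.addN Δ (.var M)) (.byW .ex α)
  | world_univ_propagation {H₁ H₂ : Set Hyp} {Δ : Ctx .n} {N M : ℕ} {α : Fml .n} :
      Deriv H₁ (.addN Δ (.var N)) (.byW .all α) → Deriv H₂ (.addN Δ (.var M)) (.cont N) →
      Deriv (H₁ ∪ H₂) (.addN Δ (.var M)) (.byW .all α)
  | incl_trans {H₁ H₂ : Set Hyp} {Δ : Ctx .n} {N M P : ℕ} :
      Deriv H₁ (.addN Δ (.var N)) (.incl M) → Deriv H₂ (.addN Δ (.var M)) (.incl P) →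
      Deriv (H₁ ∪ H₂) (.addN Δ (.var N)) (.incl P)
  | cont_trans {H₁ H₂ : Set Hyp} {Δ : Ctx .n} {N M P : ℕ} :
      Deriv H₁ (.addN Δ (.var N)) (.cont M) → Deriv H₂ (.addN Δ (.var M)) (.cont P) →
      Deriv (H₁ ∪ H₂) (.addN Δ (.var N)) (.cont P)
  | total_order_incl {t : Kind} {H₁ H₂ : Set Hyp} {Δ : Ctx .n} {N M : ℕ}
      {Θ : Ctx t} {α : Fml t} :
      Deriv H₁ Θ α → Deriv H₂ Θ α →
      Deriv ((H₁ \ {hyp (.addN Δ (.var N)) (.incl M)}) ∪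
        (H₂ \ {hyp (.addN Δ (.var M)) (.incl N)})) Θ α
  | total_order_cont {t : Kind} {H₁ H₂ : Set Hyp} {Δ : Ctx .n} {N M : ℕ}
      {Θ : Ctx t} {α : Fml t} :
      Deriv H₁ Θ α → Deriv H₂ Θ α →
      Deriv ((H₁ \ {hyp (.addN Δ (.var N)) (.cont M)}) ∪
        (H₂ \ {hyp (.addN Δ (.var M)) (.cont N)})) Θ α
  | total_order_mixed {t : Kind} {H₁ H₂ : Set Hyp} {Δ : Ctx .n} {N M : ℕ}
      {Θ : Ctx t} {α : Fml t} :
      Deriv H₁ Θ α → Deriv H₂ Θ α →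
      Deriv ((H₁ \ {hyp (.addN Δ (.var M)) (.incl N)}) ∪
        (H₂ \ {hyp (.addN Δ (.var M)) (.cont N)})) Θ α
  | truth_acceptance {s : Kind} {Δ : Ctx s} :
      ¬ Δ.HasNEx → Deriv ∅ Δ .top

/-- `φ` is a theorem: it has a derivation in the empty context without open hypotheses. -/
def Provable (φ : Fml .n) : Prop := Deriv ∅ .nil φ

/-- A set of formulas is decidable: the set of Goedel numbers of its members is recursive. -/
def DecidableSet {s : Kind} (P : Fml s → Prop) : Prop :=
  ComputablePred fun k : ℕ => ∃ φ : Fml s, φ.code = k ∧ P φ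

end PUC

/-! Derivability and validity are decided by separate arguments, because they do not coincide: by
`provable_iff_dsat` the system proves, for instance, every `α^⊚ → α^⊛`.

Derivability. The rules for reductio, implication and negation introduction carry no condition on
the context, so negation passes through `⊛` and `∗` as if they were self-dual. Hence, over a context
of variables, all labels of a sort become interchangeable (`Ent.nbhd_label_congr`,
`Ent.world_label_congr`), and the order rules make every `↑N` and `↓N` derivable (`Ent.incl`,
`Ent.cont`). What a label still does is record depth. The theorems are therefore exactly the
formulas true under all classical valuations that give each atom a truth value at each depth:
`Deriv.dsat` is soundness, and `MaxCons.dsat_iff` is the truth lemma for a maximal consistent set.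
Only finitely many atoms and depths matter for a given formula, so truth tables decide.

Validity. A countermodel to a formula with code `k` can be filtered to a finite one. Worlds are
identified when they agree on the formulas, world variables and neighbourhood variables with numbers
up to `k`. A plain quotient could confuse the denotation of a neighbourhood variable with another
neighbourhood. Each class therefore gets two copies, so that the image of a set records both which
classes it meets and which it contains. This preserves inclusion chains and reflects comparison with
the named sets (`double_eq_iff`, `sat_filtration`). The size of the countermodel is then bounded by
a primitive recursive function of `k`. World formulas reduce to neighbourhood formulas by prefixing
`⊛`.

Effectivity. In both cases a refuting table is packed into the bits of one bounded number. Its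
correctness is a primitive recursive condition on codes, as is being the code of a formula
(`isCode_iff`). -/

namespace PUC

/-! ### Soundness of PUC-ND for depth-indexed propositional valuations -/

/-- Propositional evaluation in which labels only count the depth at which a proposition symbol
is read. -/
def DSat (v : ℕ → ℕ → Prop) : {s : Kind} → Fml s → ℕ → Prop
  | _, .atom p, d => v p d
  | _, .incl _, _ => True
  | _, .cont _, _ => True
  | _, .top, _ => True
  | _, .bot, _ => False
  | _, .neg α, d => ¬ DSat v α d
  | _, .and α β, d => DSat v α d ∧ DSat v β d
  | _, .or α β, d => DSat v α d ∨ DSat v β d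
  | _, .imp α β, d => DSat v α d → DSat v β d
  | _, .byW _ α, d => DSat v α (d + 1)
  | _, .byN _ α, d => DSat v α (d + 1)

/-- The number of labels in a context. -/
def Ctx.length : {s : Kind} → Ctx s → ℕ
  | _, .nil => 0
  | _, .addN Δ _ => Δ.length + 1
  | _, .addW Δ _ => Δ.length + 1

theorem forall_mem_of_sdiff {ι : Type*} {p : ι → Prop} {H : Set ι} {a : ι} (ha : p a)
    (h : ∀ k ∈ H \ {a}, p k) : ∀ k ∈ H, p k := fun k hk => by
  by_cases e : k = a
  · exact e ▸ ha
  · exact h k ⟨hk, e⟩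

/-- At a fixed depth the evaluation is two-valued propositional logic, which justifies the
connective rules in every context. Rules that exchange one label for another preserve the length of
the context. The order hypotheses discharged by the total order rules are true outright, so one
branch suffices. Moving `⊥` to the empty context is harmless since `⊥` fails at every depth. -/
theorem Deriv.dsat {H : Set Hyp} {s : Kind} {Δ : Ctx s} {α : Fml s} (h : Deriv H Δ α)
    (v : ℕ → ℕ → Prop) (hH : ∀ h ∈ H, DSat v h.fml h.ctx.length) : DSat v α Δ.length := by
  induction h with
  | bot_classical _ ih =>
    by_contra hn
    exact ih <| forall_mem_of_sdiff (by exact hn) fun k hk => hH k hk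
  | imp_intro _ ih =>
    intro ha
    exact ih <| forall_mem_of_sdiff (by exact ha) fun k hk => hH k hk
  | neg_intro _ ih =>
    intro ha
    exact ih <| forall_mem_of_sdiff (by exact ha) fun k hk => hH k hk
  | or_elim _ _ _ _ ih₁ ih₂ ih₃ =>
    rcases ih₁ fun k hk => hH k (.inl (.inl hk)) with ha | ha
    · exact ih₂ <| forall_mem_of_sdiff (by exact ha) fun k hk => hH k (.inl (.inr hk))
    · exact ih₃ <| forall_mem_of_sdiff (by exact ha) fun k hk => hH k (.inr hk)
  | hypothesis_injection => exact hH _ rfl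
  | world_exis_elim _ _ _ _ _ _ ih₁ ih₂ =>
    have ha := ih₁ fun k hk => hH k (.inl hk)
    exact ih₂ <| forall_mem_of_sdiff (by exact ha) fun k hk => hH k (.inr hk)
  | nbhd_exis_elim _ _ _ _ _ _ ih₁ ih₂ =>
    have ha := ih₁ fun k hk => hH k (.inl hk)
    exact ih₂ <| forall_mem_of_sdiff (by exact ha) fun k hk => hH k (.inr hk)
  | total_order_incl _ _ ih₁ _ =>
    exact ih₁ <| forall_mem_of_sdiff (by trivial) fun k hk => hH k (.inl hk)
  | total_order_cont _ _ ih₁ _ =>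
    exact ih₁ <| forall_mem_of_sdiff (by trivial) fun k hk => hH k (.inl hk)
  | total_order_mixed _ _ ih₁ _ =>
    exact ih₁ <| forall_mem_of_sdiff (by trivial) fun k hk => hH k (.inl hk)
  | and_elim_left _ _ ih => exact (ih hH).1
  | and_elim_right _ _ ih => exact (ih hH).2
  | and_intro _ _ _ ih₁ ih₂ =>
    exact ⟨ih₁ fun k hk => hH k (.inl hk), ih₂ fun k hk => hH k (.inr hk)⟩
  | or_intro_left _ _ ih => exact .inl (ih hH)
  | or_intro_right _ _ ih => exact .inr (ih hH)
  | bot_intuitionistic _ ih => exact (ih hH).elim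
  | absurd_expansion _ _ _ ih => exact ih hH
  | imp_elim _ _ _ ih₁ ih₂ =>
    exact (ih₂ fun k hk => hH k (.inr hk)) (ih₁ fun k hk => hH k (.inl hk))
  | neg_elim _ _ _ ih₁ ih₂ =>
    exact (ih₂ fun k hk => hH k (.inr hk)) (ih₁ fun k hk => hH k (.inl hk))
  | context_intro_n _ ih => exact ih hH
  | context_intro_w _ ih => exact ih hH
  | context_elim_n _ ih => exact ih hH
  | context_elim_w _ ih => exact ih hH
  | world_univ_intro _ _ ih => exact ih hH
  | world_univ_elim _ _ _ ih => exact ih hH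
  | world_exis_intro _ ih => exact ih hH
  | nbhd_exis_intro _ _ ih₁ _ => exact ih₁ fun k hk => hH k (.inl hk)
  | nbhd_univ_intro _ _ ih => exact ih hH
  | nbhd_univ_wildcard _ _ ih₁ _ => exact ih₁ fun k hk => hH k (.inl hk)
  | world_exis_propagation _ _ ih₁ _ => exact ih₁ fun k hk => hH k (.inl hk)
  | world_univ_propagation _ _ ih₁ _ => exact ih₁ fun k hk => hH k (.inl hk)
  | incl_trans => trivial
  | cont_trans => trivial
  | truth_acceptance => trivial

/-! ### Entailment from a set of hypotheses -/

/-- Derivability from a subset of the hypotheses in `Γ`. -/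
def Ent (Γ : Set Hyp) {s : Kind} (Δ : Ctx s) (α : Fml s) : Prop :=
  ∃ H ⊆ Γ, Deriv H Δ α

section Ent

variable {s t : Kind} {Γ Γ' : Set Hyp} {Δ : Ctx s} {Θ : Ctx t} {α β : Fml s} {γ : Fml t}

/-- Needed for the Zorn argument in `exists_maxCons`: a derivation from the union of a chain already
lives in one member of the chain. -/
theorem Deriv.finite {H : Set Hyp} (h : Deriv H Δ α) : H.Finite := by
  induction h with
  | hypothesis_injection => exact Set.finite_singleton _
  | truth_acceptance => exact Set.finite_empty
  | bot_classical _ ih => exact ih.sdiff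
  | imp_intro _ ih => exact ih.sdiff
  | neg_intro _ ih => exact ih.sdiff
  | or_elim _ _ _ _ h₁ h₂ h₃ => exact (h₁.union h₂.sdiff).union h₃.sdiff
  | world_exis_elim _ _ _ _ _ _ h₁ h₂ => exact h₁.union h₂.sdiff
  | nbhd_exis_elim _ _ _ _ _ _ h₁ h₂ => exact h₁.union h₂.sdiff
  | total_order_incl _ _ h₁ h₂ => exact h₁.sdiff.union h₂.sdiff
  | total_order_cont _ _ h₁ h₂ => exact h₁.sdiff.union h₂.sdiff
  | total_order_mixed _ _ h₁ h₂ => exact h₁.sdiff.union h₂.sdiff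
  | _ => first | assumption | exact Set.Finite.union (by assumption) (by assumption)

theorem Ent.mono (h : Ent Γ Δ α) (hΓ : Γ ⊆ Γ') : Ent Γ' Δ α :=
  let ⟨H, hH, d⟩ := h
  ⟨H, hH.trans hΓ, d⟩

theorem Ent.weaken (h : Ent Γ Δ α) (k : Hyp) : Ent (insert k Γ) Δ α :=
  h.mono (Set.subset_insert _ _)

theorem Ent.ax (h : hyp Δ α ∈ Γ) : Ent Γ Δ α :=
  ⟨_, Set.singleton_subset_iff.2 h, .hypothesis_injection⟩

theorem Ent.here : Ent (insert (hyp Δ α) Γ) Δ α :=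
  .ax (Set.mem_insert _ _)

theorem Ent.exFalso (h : Ent Γ Δ .bot) (α : Fml s) : Ent Γ Δ α :=
  let ⟨H, hH, d⟩ := h
  ⟨H, hH, .bot_intuitionistic d⟩

theorem Ent.byContra (h : Ent (insert (hyp Δ (.neg α)) Γ) Δ .bot) : Ent Γ Δ α :=
  let ⟨_, hH, d⟩ := h
  ⟨_, Set.sdiff_singleton_subset_iff.2 hH, .bot_classical d⟩

theorem Ent.impI (h : Ent (insert (hyp Δ α) Γ) Δ β) : Ent Γ Δ (.imp α β) :=
  let ⟨_, hH, d⟩ := h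
  ⟨_, Set.sdiff_singleton_subset_iff.2 hH, .imp_intro d⟩

theorem Ent.negI (h : Ent (insert (hyp Δ α) Γ) Δ .bot) : Ent Γ Δ (.neg α) :=
  let ⟨_, hH, d⟩ := h
  ⟨_, Set.sdiff_singleton_subset_iff.2 hH, .neg_intro d⟩

theorem Ent.byN_iff {Δ : Ctx .n} {φ : NLabel} {α : Fml .w} :
    Ent Γ Δ (.byN φ α) ↔ Ent Γ (Δ.addN φ) α :=
  ⟨fun ⟨H, hH, d⟩ => ⟨H, hH, .context_intro_n d⟩, fun ⟨H, hH, d⟩ => ⟨H, hH, .context_elim_n d⟩⟩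

theorem Ent.byW_iff {Δ : Ctx .w} {φ : WLabel} {α : Fml .n} :
    Ent Γ Δ (.byW φ α) ↔ Ent Γ (Δ.addW φ) α :=
  ⟨fun ⟨H, hH, d⟩ => ⟨H, hH, .context_intro_w d⟩, fun ⟨H, hH, d⟩ => ⟨H, hH, .context_elim_w d⟩⟩

/-- Labels move freely between context and formula, so every judgement is equivalent to one in the
empty context, where no side condition on labels can fail. -/
theorem Ent.close_iff : {s : Kind} → {Δ : Ctx s} → {α : Fml s} →
    (Ent Γ .nil (Δ.close α) ↔ Ent Γ Δ α)
  | _, .nil, _ => Iff.rfl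
  | _, .addN Δ _, _ => (Ent.close_iff (Δ := Δ)).trans Ent.byN_iff
  | _, .addW Δ _, _ => (Ent.close_iff (Δ := Δ)).trans Ent.byW_iff

/-- All labels in the context are variables. -/
def Ctx.VarOnly (Δ : Ctx s) : Prop :=
  ¬ Δ.HasExis ∧ ¬ Δ.HasUniv

theorem Ctx.not_hasNAll : {s : Kind} → {Δ : Ctx s} → ¬ Δ.HasUniv → ¬ Δ.HasNAll
  | _, .nil, _ => id
  | _, .addN _ _, h => fun k => h (k.imp_right (not_imp_not.1 Ctx.not_hasNAll))
  | _, .addW _ _, h => fun k => h (.inr (not_imp_not.1 Ctx.not_hasNAll k))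

theorem Ctx.not_hasNEx : {s : Kind} → {Δ : Ctx s} → ¬ Δ.HasExis → ¬ Δ.HasNEx
  | _, .nil, _ => id
  | _, .addN _ _, h => fun k => h (k.imp_right (not_imp_not.1 Ctx.not_hasNEx))
  | _, .addW _ _, h => fun k => h (.inr (not_imp_not.1 Ctx.not_hasNEx k))

theorem Ctx.VarOnly.addN {Δ : Ctx .n} (h : Δ.VarOnly) (N : ℕ) : (Δ.addN (.var N)).VarOnly := by
  simpa [Ctx.VarOnly, Ctx.HasExis, Ctx.HasUniv] using h

theorem Ctx.VarOnly.addW {Δ : Ctx .w} (h : Δ.VarOnly) (z : ℕ) : (Δ.addW (.var z)).VarOnly := by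
  simpa [Ctx.VarOnly, Ctx.HasExis, Ctx.HasUniv] using h

theorem Ent.truth (hΔ : Δ.VarOnly) : Ent Γ Δ .top :=
  ⟨_, Set.empty_subset _, .truth_acceptance (Ctx.not_hasNEx hΔ.1)⟩

theorem Ent.andI (hΔ : Δ.VarOnly) (h₁ : Ent Γ Δ α) (h₂ : Ent Γ Δ β) : Ent Γ Δ (.and α β) :=
  let ⟨_, hH₁, d₁⟩ := h₁
  let ⟨_, hH₂, d₂⟩ := h₂
  ⟨_, Set.union_subset hH₁ hH₂, .and_intro hΔ.1 d₁ d₂⟩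

theorem Ent.andL (hΔ : Δ.VarOnly) (h : Ent Γ Δ (.and α β)) : Ent Γ Δ α :=
  let ⟨_, hH, d⟩ := h
  ⟨_, hH, .and_elim_left hΔ.1 d⟩

theorem Ent.andR (hΔ : Δ.VarOnly) (h : Ent Γ Δ (.and α β)) : Ent Γ Δ β :=
  let ⟨_, hH, d⟩ := h
  ⟨_, hH, .and_elim_right hΔ.1 d⟩

theorem Ent.orL (hΔ : Δ.VarOnly) (h : Ent Γ Δ α) : Ent Γ Δ (.or α β) :=
  let ⟨_, hH, d⟩ := h
  ⟨_, hH, .or_intro_left hΔ.2 d⟩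

theorem Ent.orR (hΔ : Δ.VarOnly) (h : Ent Γ Δ β) : Ent Γ Δ (.or α β) :=
  let ⟨_, hH, d⟩ := h
  ⟨_, hH, .or_intro_right hΔ.2 d⟩

theorem Ent.orE (hΔ : Δ.VarOnly) (h : Ent Γ Δ (.or α β)) (h₁ : Ent (insert (hyp Δ α) Γ) Θ γ)
    (h₂ : Ent (insert (hyp Δ β) Γ) Θ γ) : Ent Γ Θ γ :=
  let ⟨_, hH, d⟩ := h
  let ⟨_, hH₁, d₁⟩ := h₁
  let ⟨_, hH₂, d₂⟩ := h₂
  ⟨_, Set.union_subset (Set.union_subset hH (Set.sdiff_singleton_subset_iff.2 hH₁))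
    (Set.sdiff_singleton_subset_iff.2 hH₂), .or_elim hΔ.2 d d₁ d₂⟩

theorem Ent.mp (hΔ : Δ.VarOnly) (h₁ : Ent Γ Δ (.imp α β)) (h₂ : Ent Γ Δ α) : Ent Γ Δ β :=
  let ⟨_, hH₁, d₁⟩ := h₁
  let ⟨_, hH₂, d₂⟩ := h₂
  ⟨_, Set.union_subset hH₂ hH₁, .imp_elim hΔ.1 d₂ d₁⟩

/-- Contradictions in a variable context propagate to the empty context. -/
theorem Ent.absurd (hΔ : Δ.VarOnly) (h₁ : Ent Γ Δ (.neg α)) (h₂ : Ent Γ Δ α) :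
    Ent Γ .nil .bot := by
  obtain ⟨_, hH₁, d₁⟩ := h₁
  obtain ⟨_, hH₂, d₂⟩ := h₂
  refine ⟨_, Set.union_subset hH₂ hH₁, ?_⟩
  have d := Deriv.neg_elim hΔ.1 d₂ d₁
  by_cases hn : Δ.IsNil
  · cases Δ with
    | nil => exact d
    | addN => exact hn.elim
    | addW => exact hn.elim
  · exact .absurd_expansion (Ctx.not_hasNAll hΔ.2) hn d

theorem Ent.of_nil_bot (h : Ent Γ .nil .bot) : Ent Γ Δ α :=
  Ent.close_iff.1 (h.exFalso _)

theorem nil_varOnly : Ctx.nil.VarOnly := ⟨id, id⟩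

/-- Modus ponens is blocked by existential labels in the context. Performing it on closed formulas
in the empty context avoids this and gives a cut for arbitrary `Δ`. -/
theorem Ent.cut (h₁ : Ent Γ Δ α) (h₂ : Ent (insert (hyp .nil (Δ.close α)) Γ) Θ γ) : Ent Γ Θ γ :=
  Ent.close_iff.1 (Ent.mp nil_varOnly (Ent.close_iff.2 h₂).impI (Ent.close_iff.2 h₁))

theorem FreshN.insert {N : ℕ} (h : FreshN N Γ) (hα : ¬ α.OccN N) (hΔ : ¬ Δ.OccN N) :
    FreshN N (insert (hyp Δ α) Γ) := by
  rintro _ (rfl | hk)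
  exacts [⟨hα, hΔ⟩, h _ hk]

theorem FreshW.insert {z : ℕ} (h : FreshW z Γ) (hα : ¬ α.OccW z) (hΔ : ¬ Δ.OccW z) :
    FreshW z (insert (hyp Δ α) Γ) := by
  rintro _ (rfl | hk)
  exacts [⟨hα, hΔ⟩, h _ hk]

theorem Fml.exists_fresh {s : Kind} (α : Fml s) : ∃ B, ∀ N ≥ B, ¬ α.OccN N ∧ ¬ α.OccW N := by
  have key : ∀ {a b : ℕ} {P Q R S : ℕ → Prop}, (∀ N ≥ a, ¬ P N ∧ ¬ Q N) →
      (∀ N ≥ b, ¬ R N ∧ ¬ S N) → ∃ c, ∀ N ≥ c, ¬ (P N ∨ R N) ∧ ¬ (Q N ∨ S N) :=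
    fun {a b _ _ _ _} h₁ h₂ => ⟨max a b, fun N hN =>
      ⟨not_or.2 ⟨(h₁ N (le_trans (le_max_left _ _) hN)).1, (h₂ N (le_trans (le_max_right _ _) hN)).1⟩,
       not_or.2 ⟨(h₁ N (le_trans (le_max_left _ _) hN)).2, (h₂ N (le_trans (le_max_right _ _) hN)).2⟩⟩⟩
  induction α with
  | atom | top | bot => exact ⟨0, fun N _ => ⟨id, id⟩⟩
  | incl M | cont M => exact ⟨M + 1, fun N hN => ⟨fun h => by simp [Fml.OccN] at h; omega, id⟩⟩
  | neg α ih => exact ih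
  | and α β ih₁ ih₂ | or α β ih₁ ih₂ | imp α β ih₁ ih₂ =>
    obtain ⟨a, ha⟩ := ih₁
    obtain ⟨b, hb⟩ := ih₂
    exact key ha hb
  | byW φ α ih =>
    obtain ⟨a, ha⟩ := ih
    -- The code of the variable `N` is `N + 2`, so a variable numbered at least `φ.code` cannot be
    -- `φ`.
    refine ⟨max a φ.code, fun N hN => ⟨(ha N (by omega)).1, ?_⟩⟩
    rintro (h | h)
    · subst h; simp [WLabel.code] at hN
    · exact (ha N (by omega)).2 h
  | byN φ α ih =>
    obtain ⟨a, ha⟩ := ih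
    refine ⟨max a φ.code, fun N hN => ⟨?_, (ha N (by omega)).2⟩⟩
    rintro (h | h)
    · subst h; simp [NLabel.code] at hN
    · exact (ha N (by omega)).1 h

theorem Ctx.occN_close {N : ℕ} : {s : Kind} → {Δ : Ctx s} → {α : Fml s} →
    ((Δ.close α).OccN N ↔ Δ.OccN N ∨ α.OccN N)
  | _, .nil, _ => by simp [Ctx.close, Ctx.OccN]
  | _, .addN Δ _, _ => (Ctx.occN_close (Δ := Δ)).trans (by simp [Ctx.OccN, Fml.OccN]; tauto)
  | _, .addW Δ _, _ => (Ctx.occN_close (Δ := Δ)).trans (by simp [Ctx.OccN, Fml.OccN])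

theorem Ctx.occW_close {N : ℕ} : {s : Kind} → {Δ : Ctx s} → {α : Fml s} →
    ((Δ.close α).OccW N ↔ Δ.OccW N ∨ α.OccW N)
  | _, .nil, _ => by simp [Ctx.close, Ctx.OccW]
  | _, .addN Δ _, _ => (Ctx.occW_close (Δ := Δ)).trans (by simp [Ctx.OccW, Fml.OccW])
  | _, .addW Δ _, _ => (Ctx.occW_close (Δ := Δ)).trans (by simp [Ctx.OccW, Fml.OccW]; tauto)

end Ent

/-! ### Collapse of labels -/

section Collapse

variable {Γ : Set Hyp}

theorem Ent.nbhd_of_all {Δ : Ctx .n} {α : Fml .w} (hΔ : Δ.VarOnly) (h : Ent Γ (Δ.addN .all) α)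
    (N : ℕ) : Ent Γ (Δ.addN (.var N)) α :=
  let ⟨_, hH, d⟩ := h
  let ⟨_, hH', d'⟩ := Ent.truth (Γ := Γ) (hΔ.addN N)
  ⟨_, Set.union_subset hH hH', .nbhd_univ_wildcard d d'⟩

theorem Ent.nbhd_ex {Δ : Ctx .n} {α : Fml .w} {N : ℕ} (h : Ent Γ (Δ.addN (.var N)) α) :
    Ent Γ (Δ.addN .ex) α :=
  let ⟨_, hH, d⟩ := h
  -- The second premise of the rule should guarantee that a neighbourhood exists. Implication
  -- introduction is unrestricted, so `⊤ → ⊤` supplies it for free, while `⊤` itself is not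
  -- available by `truth_acceptance` under `⊚`.
  let ⟨_, hH', d'⟩ : Ent Γ (Δ.addN .ex) (.imp .top .top) := Ent.here.impI
  ⟨_, Set.union_subset hH hH', .nbhd_exis_intro d d'⟩

theorem Ent.nbhd_exE {Δ : Ctx .n} {α : Fml .w} {t : Kind} {Θ : Ctx t} {γ : Fml t} {N : ℕ}
    (hα : ¬ α.OccN N) (hΔ : ¬ Δ.OccN N) (hΘ : ¬ Θ.OccN N) (hΓ : FreshN N Γ)
    (h : Ent Γ (Δ.addN .ex) α) (h' : Ent (insert (hyp (Δ.addN (.var N)) α) Γ) Θ γ) :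
    Ent Γ Θ γ := by
  obtain ⟨H, hH, d⟩ := h
  obtain ⟨H', hH', d'⟩ := h'
  have := Set.union_subset hH (Set.sdiff_singleton_subset_iff.2 hH')
  exact ⟨_, this, .nbhd_exis_elim hα hΔ hΘ (fun k hk => hΓ k (this hk)) d d'⟩

theorem Ent.world_exE {Δ : Ctx .w} {α : Fml .n} {t : Kind} {Θ : Ctx t} {γ : Fml t} {z : ℕ}
    (hα : ¬ α.OccW z) (hΔ : ¬ Δ.OccW z) (hΘ : ¬ Θ.OccW z) (hΓ : FreshW z Γ)
    (h : Ent Γ (Δ.addW .ex) α) (h' : Ent (insert (hyp (Δ.addW (.var z)) α) Γ) Θ γ) :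
    Ent Γ Θ γ := by
  obtain ⟨H, hH, d⟩ := h
  obtain ⟨H', hH', d'⟩ := h'
  have := Set.union_subset hH (Set.sdiff_singleton_subset_iff.2 hH')
  exact ⟨_, this, .world_exis_elim hα hΔ hΘ (fun k hk => hΓ k (this hk)) d d'⟩

/-- The source of the collapse. Reductio may be applied under `⊛`, so it is enough to refute `Δ,⊛ :
¬α`. Opening `⊚` with a fresh `N` gives `α` at `N`, and instantiating `⊛` gives `¬α` at the same
`N`; the contradiction is exported to the empty context. -/
theorem Ent.nbhd_all_of_ex {Δ : Ctx .n} {α : Fml .w} (hΔ : Δ.VarOnly)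
    (h : Ent Γ (Δ.addN .ex) α) : Ent Γ (Δ.addN .all) α := by
  -- `Γ` may be infinite and mention every variable. Cutting down to the single hypothesis `α^⊚`,
  -- closed under `Δ`, leaves a fresh variable.
  refine h.cut (Ent.mono (Γ := {hyp .nil ((Δ.addN .ex).close α)}) ?_ (by simp))
  obtain ⟨N, hN⟩ := ((Δ.addN .ex).close α).exists_fresh
  replace hN := (hN N le_rfl).1
  have hN' := hN
  simp only [Ctx.occN_close, Ctx.OccN, not_or] at hN'
  refine .byContra (.of_nil_bot (.nbhd_exE (N := N) hN'.2 hN'.1.2 id ?_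
    (Ent.close_iff.1 (.ax (.inr rfl))) ?_))
  · refine FreshN.insert (fun k hk => ?_) hN'.2 (by simp [Ctx.OccN, hN'.1.2])
    cases hk
    exact ⟨hN, id⟩
  · exact .absurd (hΔ.addN N) (Ent.here.weaken _ |>.nbhd_of_all hΔ N) .here

theorem Ent.nbhd_label_congr {Δ : Ctx .n} {α : Fml .w} (hΔ : Δ.VarOnly) {φ ψ : NLabel}
    (h : Ent Γ (Δ.addN φ) α) : Ent Γ (Δ.addN ψ) α := by
  have h' : Ent Γ (Δ.addN .all) α := by
    cases φ with
    | all => exact h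
    | ex => exact h.nbhd_all_of_ex hΔ
    | var N => exact h.nbhd_ex.nbhd_all_of_ex hΔ
  cases ψ with
  | all => exact h'
  | ex => exact (h'.nbhd_of_all hΔ 0).nbhd_ex
  | var N => exact h'.nbhd_of_all hΔ N

theorem Ent.world_ex {Δ : Ctx .w} {α : Fml .n} {z : ℕ} (h : Ent Γ (Δ.addW (.var z)) α) :
    Ent Γ (Δ.addW .ex) α :=
  let ⟨_, hH, d⟩ := h
  ⟨_, hH, .world_exis_intro d⟩

theorem Ent.world_of_all_fresh {Δ : Ctx .w} {α : Fml .n} {z : ℕ} (hα : ¬ α.OccW z)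
    (hΔ : ¬ Δ.OccW z) (h : Ent Γ (Δ.addW .all) α) : Ent Γ (Δ.addW (.var z)) α :=
  let ⟨_, hH, d⟩ := h
  ⟨_, hH, .world_univ_elim hα hΔ d⟩

theorem Ent.world_all_of_ex {Δ : Ctx .w} {α : Fml .n} (hΔ : Δ.VarOnly)
    (h : Ent Γ (Δ.addW .ex) α) : Ent Γ (Δ.addW .all) α := by
  refine h.cut (Ent.mono (Γ := {hyp .nil ((Δ.addW .ex).close α)}) ?_ (by simp))
  obtain ⟨N, hN⟩ := ((Δ.addW .ex).close α).exists_fresh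
  replace hN := (hN N le_rfl).2
  have hN' := hN
  simp only [Ctx.occW_close, Ctx.OccW, not_or] at hN'
  refine .byContra (.of_nil_bot (.world_exE (z := N) hN'.2 hN'.1.2 id ?_
    (Ent.close_iff.1 (.ax (.inr rfl))) ?_))
  · refine FreshW.insert (fun k hk => ?_) hN'.2 (by simp [Ctx.OccW, hN'.1.2])
    cases hk
    exact ⟨hN, id⟩
  · exact .absurd (hΔ.addW N)
      (Ent.here.weaken _ |>.world_of_all_fresh (by exact hN'.2) hN'.1.2) .here

/-- Lifts the freshness condition on instantiating `∗`. If `¬α` held at `z`, it would hold at `•`,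
hence at `∗` by the collapse, hence at a fresh world variable, where `α` holds as well. -/
theorem Ent.world_of_all {Δ : Ctx .w} {α : Fml .n} (hΔ : Δ.VarOnly)
    (h : Ent Γ (Δ.addW .all) α) (z : ℕ) : Ent Γ (Δ.addW (.var z)) α := by
  obtain ⟨N, hN⟩ := ((Δ.addW .ex).close α).exists_fresh
  replace hN := (hN N le_rfl).2
  simp only [Ctx.occW_close, Ctx.OccW, not_or] at hN
  refine .byContra (.of_nil_bot (.absurd (hΔ.addW N)
    ((Ent.here.world_ex.world_all_of_ex hΔ).world_of_all_fresh (by exact hN.2) hN.1.2)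
    ((h.weaken _).world_of_all_fresh hN.2 hN.1.2)))

theorem Ent.world_label_congr {Δ : Ctx .w} {α : Fml .n} (hΔ : Δ.VarOnly) {φ ψ : WLabel}
    (h : Ent Γ (Δ.addW φ) α) : Ent Γ (Δ.addW ψ) α := by
  have h' : Ent Γ (Δ.addW .all) α := by
    cases φ with
    | all => exact h
    | ex => exact h.world_all_of_ex hΔ
    | var N => exact h.world_ex.world_all_of_ex hΔ
  cases ψ with
  | all => exact h'
  | ex => exact (h'.world_of_all hΔ 0).world_ex
  | var N => exact h'.world_of_all hΔ N

/-- With both variables equal to `M`, the total order rule discharges the same hypothesis in both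
branches, so `Δ,M : ↑M` has a derivation without hypotheses. Generalisation over `M` only inspects
open hypotheses, so it is permitted although `M` occurs in `↑M`. This yields `Δ,⊛ : ↑M`, which is
then instantiated at `N`. -/
theorem Ent.incl {Δ : Ctx .n} (hΔ : Δ.VarOnly) (N M : ℕ) : Ent Γ (Δ.addN (.var N)) (.incl M) := by
  refine .nbhd_of_all hΔ ⟨∅, Set.empty_subset _, .nbhd_univ_intro (N := M) (by simp [FreshN]) ?_⟩ N
  simpa [hyp] using Deriv.total_order_incl (Δ := Δ) (N := M) (M := M)
    (Deriv.hypothesis_injection (Δ := Δ.addN (.var M)) (α := .incl M)) .hypothesis_injection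

theorem Ent.cont {Δ : Ctx .n} (hΔ : Δ.VarOnly) (N M : ℕ) : Ent Γ (Δ.addN (.var N)) (.cont M) := by
  refine .nbhd_of_all hΔ ⟨∅, Set.empty_subset _, .nbhd_univ_intro (N := M) (by simp [FreshN]) ?_⟩ N
  simpa [hyp] using Deriv.total_order_cont (Δ := Δ) (N := M) (M := M)
    (Deriv.hypothesis_injection (Δ := Δ.addN (.var M)) (α := .cont M)) .hypothesis_injection

/-- Replace the top label, push it into the formula, and recurse on the shorter context. This is
what makes the valuation in `MaxCons.dsat_iff` depend on depth alone. -/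
theorem Ent.varOnly_congr : {s : Kind} → {Δ Δ' : Ctx s} → {α : Fml s} → Δ.VarOnly → Δ'.VarOnly →
    Δ.length = Δ'.length → Ent Γ Δ α → Ent Γ Δ' α
  | _, .nil, .nil, _, _, _, _, h => h
  | _, .addN Δ φ, .addN Δ' φ', α, hΔ, hΔ', hl, h => by
    simp only [Ctx.VarOnly, Ctx.HasExis, Ctx.HasUniv, not_or] at hΔ hΔ'
    exact Ent.byN_iff.1 (Ent.varOnly_congr ⟨hΔ.1.2, hΔ.2.2⟩ ⟨hΔ'.1.2, hΔ'.2.2⟩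
      (Nat.succ_injective hl) (Ent.byN_iff.2 (h.nbhd_label_congr ⟨hΔ.1.2, hΔ.2.2⟩ (ψ := φ'))))
  | _, .addW Δ φ, .addW Δ' φ', α, hΔ, hΔ', hl, h => by
    simp only [Ctx.VarOnly, Ctx.HasExis, Ctx.HasUniv, not_or] at hΔ hΔ'
    exact Ent.byW_iff.1 (Ent.varOnly_congr ⟨hΔ.1.2, hΔ.2.2⟩ ⟨hΔ'.1.2, hΔ'.2.2⟩
      (Nat.succ_injective hl) (Ent.byW_iff.2 (h.world_label_congr ⟨hΔ.1.2, hΔ.2.2⟩ (ψ := φ'))))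
  | _, .nil, .addW _ _, _, _, _, hl, _ => by simp [Ctx.length] at hl
  | _, .addW _ _, .nil, _, _, _, hl, _ => by simp [Ctx.length] at hl

end Collapse

/-! ### Completeness -/

/-- A maximal set of hypotheses from which `⊥` is not derivable. -/
structure MaxCons (Γ : Set Hyp) : Prop where
  cons : ¬ Ent Γ .nil .bot
  max : ∀ α : Fml .n, ¬ Ent Γ .nil α → Ent (insert (hyp .nil α) Γ) .nil .bot

theorem exists_maxCons {Γ₀ : Set Hyp} (h₀ : ¬ Ent Γ₀ .nil .bot) :
    ∃ Γ, Γ₀ ⊆ Γ ∧ MaxCons Γ := by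
  obtain ⟨Γ, h, hΓ⟩ := zorn_subset_nonempty {Γ : Set Hyp | ¬ Ent Γ .nil .bot} (fun c hc hchain hne => by
    refine ⟨⋃₀ c, ?_, fun s hs => Set.subset_sUnion_of_mem hs⟩
    rintro ⟨H, hH, d⟩
    obtain ⟨T, hT, hHT⟩ := DirectedOn.exists_mem_subset_of_finite_of_subset_sUnion hne
      hchain.directedOn d.finite hH
    exact hc hT ⟨H, hHT, d⟩) Γ₀ h₀
  refine ⟨Γ, h, hΓ.prop, fun α hα => ?_⟩
  by_contra hn
  exact hα (.ax (hΓ.le_of_ge (y := insert (hyp .nil α) Γ) hn (Set.subset_insert _ _)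
    (Set.mem_insert _ _)))

namespace MaxCons

variable {Γ : Set Hyp} {s : Kind} {Δ : Ctx s} {α β : Fml s}

/-- Negation introduction has no side condition, so this holds in every context; only the converse
in `ent_neg_iff` needs a context of variables, to turn the clash into `⊥`. -/
theorem ent_neg_of_not (hΓ : MaxCons Γ) (h : ¬ Ent Γ Δ α) : Ent Γ Δ (.neg α) :=
  .negI (.of_nil_bot (Ent.here.cut
    ((hΓ.max _ (mt Ent.close_iff.1 h)).mono (Set.insert_subset_insert (Set.subset_insert _ _)))))

theorem ent_neg_iff (hΓ : MaxCons Γ) (hΔ : Δ.VarOnly) : Ent Γ Δ (.neg α) ↔ ¬ Ent Γ Δ α :=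
  ⟨fun h h' => hΓ.cons (.absurd hΔ h h'), hΓ.ent_neg_of_not⟩

theorem ent_or_iff (hΓ : MaxCons Γ) (hΔ : Δ.VarOnly) :
    Ent Γ Δ (.or α β) ↔ Ent Γ Δ α ∨ Ent Γ Δ β := by
  refine ⟨fun h => ?_, fun h => h.elim (.orL hΔ) (.orR hΔ)⟩
  by_contra! hn
  exact hΓ.cons (h.orE hΔ (.absurd hΔ ((hΓ.ent_neg_of_not hn.1).weaken _) .here)
    (.absurd hΔ ((hΓ.ent_neg_of_not hn.2).weaken _) .here))

theorem ent_imp_iff (hΓ : MaxCons Γ) (hΔ : Δ.VarOnly) :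
    Ent Γ Δ (.imp α β) ↔ (Ent Γ Δ α → Ent Γ Δ β) := by
  refine ⟨fun h => h.mp hΔ, fun h => ?_⟩
  by_cases hα : Ent Γ Δ α
  · exact ((h hα).weaken _).impI
  · exact .impI (.of_nil_bot (.absurd hΔ ((hΓ.ent_neg_of_not hα).weaken _) .here))

/-- The truth lemma. An atom is true at depth `d` when it is derivable in some, equivalently every,
variable context of length `d`. A label in the formula is traded for the variable `0`, which keeps
the context within the scope of the induction. -/
theorem dsat_iff (hΓ : MaxCons Γ) {s : Kind} (α : Fml s) (Δ : Ctx s) (hΔ : Δ.VarOnly) :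
    DSat (fun p d => ∃ Θ : Ctx .n, Θ.VarOnly ∧ Θ.length = d ∧ Ent Γ Θ (.atom p)) α Δ.length ↔
      Ent Γ Δ α := by
  induction α with
  | atom p =>
    exact ⟨fun ⟨Θ, hΘ, hl, h⟩ => h.varOnly_congr hΘ hΔ hl, fun h => ⟨Δ, hΔ, rfl, h⟩⟩
  | incl M =>
    refine iff_of_true trivial ?_
    cases Δ with
    | addN Δ φ =>
      simp only [Ctx.VarOnly, Ctx.HasExis, Ctx.HasUniv, not_or] at hΔ
      exact (Ent.incl ⟨hΔ.1.2, hΔ.2.2⟩ 0 M).nbhd_label_congr ⟨hΔ.1.2, hΔ.2.2⟩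
  | cont M =>
    refine iff_of_true trivial ?_
    cases Δ with
    | addN Δ φ =>
      simp only [Ctx.VarOnly, Ctx.HasExis, Ctx.HasUniv, not_or] at hΔ
      exact (Ent.cont ⟨hΔ.1.2, hΔ.2.2⟩ 0 M).nbhd_label_congr ⟨hΔ.1.2, hΔ.2.2⟩
  | top => exact iff_of_true trivial (.truth hΔ)
  | bot => exact iff_of_false id fun h => hΓ.cons (.absurd hΔ (Ent.exFalso h _) h)
  | neg α ih => exact (not_congr (ih Δ hΔ)).trans (hΓ.ent_neg_iff hΔ).symm
  | and α β ih₁ ih₂ =>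
    exact (and_congr (ih₁ Δ hΔ) (ih₂ Δ hΔ)).trans
      ⟨fun h => .andI hΔ h.1 h.2, fun h => ⟨h.andL hΔ, h.andR hΔ⟩⟩
  | or α β ih₁ ih₂ => exact (or_congr (ih₁ Δ hΔ) (ih₂ Δ hΔ)).trans (hΓ.ent_or_iff hΔ).symm
  | imp α β ih₁ ih₂ =>
    exact (imp_congr (ih₁ Δ hΔ) (ih₂ Δ hΔ)).trans (hΓ.ent_imp_iff hΔ).symm
  | byW φ α ih =>
    refine (ih (Δ.addW (.var 0)) (hΔ.addW 0)).trans (Iff.trans ?_ Ent.byW_iff.symm)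
    exact ⟨.world_label_congr hΔ, .world_label_congr hΔ⟩
  | byN φ α ih =>
    refine (ih (Δ.addN (.var 0)) (hΔ.addN 0)).trans (Iff.trans ?_ Ent.byN_iff.symm)
    exact ⟨.nbhd_label_congr hΔ, .nbhd_label_congr hΔ⟩

end MaxCons

/-- A formula is a theorem of PUC-ND iff it holds under all depth-indexed propositional
valuations. -/
theorem provable_iff_dsat (φ : Fml .n) : Provable φ ↔ ∀ v, DSat v φ 0 := by
  refine ⟨fun h v => h.dsat v (by simp), fun h => ?_⟩
  by_contra hn
  obtain ⟨Γ, hΓ, hm⟩ := exists_maxCons (Γ₀ := {hyp .nil (.neg φ)}) (fun hb => hn (by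
    obtain ⟨H, hH, d⟩ := Ent.byContra (Γ := ∅) (α := φ) (by simpa using hb)
    rwa [Set.subset_empty_iff.1 hH] at d))
  exact (hm.ent_neg_iff nil_varOnly).1 (.ax (hΓ rfl)) ((hm.dsat_iff φ .nil nil_varOnly).1 (h _))

/-! ### Finite model property -/


section Filtration

variable {W : Type u} (F : Frame W) (σ : Assignment W) (k : ℕ)

/-- The formulas with Goedel number at most `k` that hold at a world, the world variables below
`k + 1` that denote it, and the neighbourhood variables below `k + 1` whose denotation
contains it. -/
noncomputable def worldType (w : W) : Fin (k + 1) → Bool × Bool × Bool :=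
  open Classical in fun i =>
    (decide (∃ α : Fml .n, α.code = i ∧ Sat F σ α w), decide (w = σ.world i),
      decide (w ∈ σ.nbhd i))

variable {F σ k}

section

variable {v w : W} (h : worldType F σ k v = worldType F σ k w)
include h

theorem sat_congr_of_worldType_eq {α : Fml .n} (hα : α.code ≤ k) :
    Sat F σ α v ↔ Sat F σ α w := by
  have := congrArg Prod.fst (congrFun h ⟨α.code, Nat.lt_succ_of_le hα⟩)
  simpa [worldType, Fml.code_injective.eq_iff] using this

theorem eq_world_congr_of_worldType_eq {z : ℕ} (hz : z ≤ k) : v = σ.world z ↔ w = σ.world z := by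
  simpa [worldType] using congrArg (·.2.1) (congrFun h ⟨z, Nat.lt_succ_of_le hz⟩)

theorem mem_nbhd_congr_of_worldType_eq {N : ℕ} (hN : N ≤ k) : v ∈ σ.nbhd N ↔ w ∈ σ.nbhd N := by
  simpa [worldType] using congrArg (·.2.2) (congrFun h ⟨N, Nat.lt_succ_of_le hN⟩)

end

variable {T : Type*} (τ : W → T)

/-- The image of a set of worlds in a filtration with two copies of each class: the second copy
of a class belongs to the image iff the whole class is in the set. -/
def double (S : Set W) : Set (T × Bool) :=
  {q | ∃ v ∈ S, τ v = q.1 ∧ (q.2 = true → ∀ w, τ w = q.1 → w ∈ S)}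

variable {τ}

theorem double_mono {S S' : Set W} (h : S ⊆ S') : double τ S ⊆ double τ S' :=
  fun _ ⟨v, hv, e, hq⟩ => ⟨v, h hv, e, fun hb w hw => h (hq hb w hw)⟩

theorem mem_double_false {S : Set W} {t : T} :
    (t, false) ∈ double τ S ↔ ∃ v ∈ S, τ v = t := by
  simp [double]

/-- A set of worlds is saturated if it is a union of classes. -/
def Saturated (τ : W → T) (S : Set W) : Prop :=
  ∀ v w, τ v = τ w → v ∈ S → w ∈ S

/-- For `v ∈ A` the second copy of its class lies in the image of `A` by saturation; its presence in
the image of `S` forces the whole class, in particular `v`, into `S`. -/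
theorem double_subset_iff_left {A S : Set W} (hA : Saturated τ A) :
    double τ A ⊆ double τ S ↔ A ⊆ S := by
  refine ⟨fun h v hv => ?_, double_mono⟩
  obtain ⟨_, _, _, h⟩ := h (show (τ v, true) ∈ double τ A from
    ⟨v, hv, rfl, fun _ w hw => hA v w hw.symm hv⟩)
  exact h rfl v rfl

/-- Here the first copy suffices: if the class of `v` meets `A`, saturation puts `v` in `A`. -/
theorem double_subset_iff_right {A S : Set W} (hA : Saturated τ A) :
    double τ S ⊆ double τ A ↔ S ⊆ A := by
  refine ⟨fun h v hv => ?_, double_mono⟩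
  obtain ⟨w, hw, e⟩ := mem_double_false.1 (h (mem_double_false.2 ⟨v, hv, rfl⟩))
  exact hA w v e hw

/-- A saturated set shares its image with no other set, saturated or not. Thus the filtration makes
a named set a neighbourhood only where it was one before. -/
theorem double_eq_iff {A S : Set W} (hA : Saturated τ A) : double τ S = double τ A ↔ S = A := by
  simp only [Set.Subset.antisymm_iff, double_subset_iff_left hA, double_subset_iff_right hA]

variable (F σ τ) in
/-- The filtration of a frame along `τ`; the neighbourhoods of a class are those of a
representative. -/
noncomputable def Frame.filtration [Nonempty W] : Frame (T × Bool) where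
  nest q := double τ '' F.nest (Function.invFun τ q.1)
  nested := by
    rintro q _ ⟨S, hS, rfl⟩ _ ⟨S', hS', rfl⟩
    exact (F.nested _ S hS S' hS').imp double_mono double_mono
  val p := {q | Function.invFun τ q.1 ∈ F.val p}

variable (σ τ) in
/-- The assignment induced on a filtration. -/
def Assignment.filtration : Assignment (T × Bool) where
  world z := (τ (σ.world z), false)
  nbhd N := double τ (σ.nbhd N)
  nbhd_nonempty N :=
    let ⟨v, hv⟩ := σ.nbhd_nonempty N
    ⟨_, mem_double_false.2 ⟨v, hv, rfl⟩⟩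

/-- The relation between structures over the filtration and over the original frame. -/
def FiltrationRel [Nonempty W] (F : Frame W) (τ : W → T) :
    {s : Kind} → Struc (F.filtration τ) s → Struc F s → Prop
  | .n => fun q w => q.1 = τ w
  | .w => fun X Y => Function.invFun τ X.ref.1 = Y.ref ∧ X.nbhd = double τ Y.nbhd

/-- The code bound passes to subformulas and also bounds the variables occurring, so everything the
formula can test is recorded in the type. In particular the denotations of its neighbourhood
variables are saturated. -/
theorem sat_filtration [Nonempty W]
    (hτ : ∀ v w, τ v = τ w → worldType F σ k v = worldType F σ k w)
    {s : Kind} (α : Fml s) (hα : α.code ≤ k)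
    (x : Struc (F.filtration τ) s) (y : Struc F s) (h : FiltrationRel F τ x y) :
    Sat (F.filtration τ) (σ.filtration τ) α x ↔ Sat F σ α y := by
  have inv : ∀ w, τ (Function.invFun τ (τ w)) = τ w := fun w => Function.invFun_eq ⟨w, rfl⟩
  have sat : ∀ N ≤ k, Saturated τ (σ.nbhd N) := fun N hN v w e =>
    (mem_nbhd_congr_of_worldType_eq (hτ _ _ e) hN).1
  have nst : ∀ q : _ × Bool, ∀ N ≤ k, double τ (σ.nbhd N) ∈ (F.filtration τ).nest q ↔
      σ.nbhd N ∈ F.nest (Function.invFun τ q.1) := fun q N hN =>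
    ⟨fun ⟨S, hS, e⟩ => (double_eq_iff (sat N hN)).1 e ▸ hS, fun h => ⟨_, h, rfl⟩⟩
  have pr : ∀ {a b}, Nat.pair a b ≤ k → b ≤ k := fun h => (Nat.right_le_pair _ _).trans h
  have pl : ∀ {a b}, Nat.pair a b ≤ k → a ≤ k := fun h => (Nat.left_le_pair _ _).trans h
  induction α with
  | atom p =>
    obtain ⟨q, b⟩ := x
    obtain rfl : q = τ y := h
    exact sat_congr_of_worldType_eq (α := .atom p) (hτ _ _ (inv y)) hα
  | incl M =>
    obtain ⟨q, _, hq⟩ := x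
    obtain ⟨_, S, hS⟩ := y
    obtain ⟨rfl : Function.invFun τ q.1 = _, rfl : _ = double τ S⟩ := h
    exact and_congr (nst q M (pr hα)) (double_subset_iff_left (sat M (pr hα)))
  | cont M =>
    obtain ⟨q, _, hq⟩ := x
    obtain ⟨_, S, hS⟩ := y
    obtain ⟨rfl : Function.invFun τ q.1 = _, rfl : _ = double τ S⟩ := h
    exact and_congr (nst q M (pr hα)) (double_subset_iff_right (sat M (pr hα)))
  | top => exact Iff.rfl
  | bot => exact Iff.rfl
  | neg α ih => exact not_congr (ih (pr hα) x y h)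
  | and α β ih₁ ih₂ => exact and_congr (ih₁ (pl (pr hα)) x y h) (ih₂ (pr (pr hα)) x y h)
  | or α β ih₁ ih₂ => exact or_congr (ih₁ (pl (pr hα)) x y h) (ih₂ (pr (pr hα)) x y h)
  | imp α β ih₁ ih₂ =>
    exact or_congr (not_congr (ih₁ (pl (pr hα)) x y h)) (ih₂ (pr (pr hα)) x y h)
  | byW φ α ih =>
    replace ih : ∀ v b, Sat (F.filtration τ) (σ.filtration τ) α (τ v, b) ↔ Sat F σ α v :=
      fun v b => ih (pr (pr hα)) (τ v, b) v rfl
    obtain ⟨q, _, hq⟩ := x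
    obtain ⟨_, S, hS⟩ := y
    obtain ⟨rfl : Function.invFun τ q.1 = _, rfl : _ = double τ S⟩ := h
    cases φ with
    | all =>
      refine ⟨fun h v hv => (ih v false).1 (h _ (mem_double_false.2 ⟨v, hv, rfl⟩)), ?_⟩
      rintro h ⟨_, b⟩ ⟨v, hv, rfl, _⟩
      exact (ih v b).2 (h v hv)
    | ex =>
      constructor
      · rintro ⟨⟨_, b⟩, ⟨v, hv, rfl, _⟩, h⟩
        exact ⟨v, hv, (ih v b).1 h⟩
      · rintro ⟨v, hv, h⟩
        exact ⟨_, mem_double_false.2 ⟨v, hv, rfl⟩, (ih v false).2 h⟩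
    | var z =>
      refine and_congr (mem_double_false.trans ⟨?_, fun h => ⟨_, h, rfl⟩⟩) (ih _ _)
      have hz : z ≤ k := by
        have := pl (pr hα)
        simp only [WLabel.code] at this
        omega
      rintro ⟨v, hv, e⟩
      -- The type records equality with `σ.world z`, so the class of that world is a singleton.
      exact (eq_world_congr_of_worldType_eq (hτ _ _ e) hz).2 rfl ▸ hv
  | byN φ α ih =>
    obtain ⟨q, b⟩ := x
    obtain rfl : q = τ y := h
    -- Neighbourhoods in the filtration come from the representative of the class, so the claim is
    -- first moved from `y` to it; the two have the same type.
    rw [← sat_congr_of_worldType_eq (hτ _ _ (inv y)) hα]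
    replace ih : ∀ (S : Set W) hS hS', Sat (F.filtration τ) (σ.filtration τ) α
        ⟨(τ y, b), double τ S, hS⟩ ↔ Sat F σ α ⟨Function.invFun τ (τ y), S, hS'⟩ :=
      fun S hS hS' => ih (pr (pr hα)) _ _ ⟨rfl, rfl⟩
    cases φ with
    | all =>
      refine ⟨fun h S hS => (ih S ⟨S, hS, rfl⟩ hS).1 (h _ _), ?_⟩
      rintro h _ ⟨S, hS, rfl⟩
      exact (ih S _ hS).2 (h S hS)
    | ex =>
      constructor
      · rintro ⟨_, ⟨S, hS, rfl⟩, h⟩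
        exact ⟨S, hS, (ih S _ hS).1 h⟩
      · rintro ⟨S, hS, h⟩
        exact ⟨_, ⟨S, hS, rfl⟩, (ih S _ hS).2 h⟩
    | var N =>
      have hN : N ≤ k := by
        have := pl (pr hα)
        simp only [NLabel.code] at this
        omega
      exact ⟨fun ⟨hS, h⟩ => ⟨(nst _ N hN).1 hS, (ih _ hS _).1 h⟩,
        fun ⟨hS, h⟩ => ⟨(nst (τ y, b) N hN).2 hS, (ih _ _ hS).2 h⟩⟩

/-- A formula with Goedel number at most `k` that is not valid has a countermodel with
`2 * 8 ^ (k + 1)` worlds. -/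
theorem exists_finite_countermodel {φ : Fml .n} (hφ : φ.code ≤ k) (h : ¬ Valid.{u} φ) :
    ∃ (W : Type) (_ : W ≃ Fin (2 * 8 ^ (k + 1))) (F : Frame W) (σ : Assignment W) (x : W),
      ¬ Sat F σ φ x := by
  simp only [Valid, not_forall] at h
  obtain ⟨W, F, σ, x, h⟩ := h
  have : Nonempty W := ⟨x⟩
  refine ⟨(Fin (k + 1) → Bool × Bool × Bool) × Bool,
    Fintype.equivFinOfCardEq (by simp [mul_comm]), F.filtration (worldType F σ k),
    σ.filtration (worldType F σ k), (worldType F σ k x, false), ?_⟩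
  exact (not_congr (sat_filtration (fun _ _ => id) φ hφ _ x (by exact rfl))).2 h

end Filtration

/-! ### Truth tables -/

theorem exists_bitmask (L : ℕ) (f : ℕ → Prop) :
    ∃ t < 2 ^ L, ∀ i < L, t.testBit i = true ↔ f i := by
  classical
  exact ⟨Nat.ofBits fun i : Fin L => decide (f i), Nat.ofBits_lt_two_pow _, fun i hi => by
    simp [Nat.testBit_ofBits_lt _ _ hi]⟩

/-- `c` is the Goedel number of a formula of kind `s`. -/
def IsCode (s : Kind) (c : ℕ) : Prop := ∃ α : Fml s, α.code = c

theorem Fml.isCode {s : Kind} (α : Fml s) : IsCode s α.code := ⟨α, rfl⟩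

/-- `P` respects the propositional connectives on Goedel numbers at most `k`. -/
def BoolTable (k : ℕ) (s : Kind) (P : ℕ → Prop) : Prop :=
  (Nat.pair 3 0 ≤ k → P (Nat.pair 3 0)) ∧ (Nat.pair 4 0 ≤ k → ¬ P (Nat.pair 4 0)) ∧
  ∀ a < k + 1, IsCode s a → (Nat.pair 5 a ≤ k → (P (Nat.pair 5 a) ↔ ¬ P a)) ∧
    ∀ b < k + 1, IsCode s b →
      (Nat.pair 6 (Nat.pair a b) ≤ k → (P (Nat.pair 6 (Nat.pair a b)) ↔ P a ∧ P b)) ∧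
      (Nat.pair 7 (Nat.pair a b) ≤ k → (P (Nat.pair 7 (Nat.pair a b)) ↔ P a ∨ P b)) ∧
      (Nat.pair 8 (Nat.pair a b) ≤ k → (P (Nat.pair 8 (Nat.pair a b)) ↔ ¬ P a ∨ P b))

theorem le_of_pair_le_right {a b k : ℕ} (h : Nat.pair a b ≤ k) : b ≤ k :=
  (Nat.right_le_pair a b).trans h

theorem le_of_pair_le_left {a b k : ℕ} (h : Nat.pair a b ≤ k) : a ≤ k :=
  (Nat.left_le_pair a b).trans h

namespace BoolTable

variable {k : ℕ} {s : Kind} {P : ℕ → Prop} (h : BoolTable k s P) {α β : Fml s}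
include h

theorem neg (hk : (Fml.neg α).code ≤ k) : P (Fml.neg α).code ↔ ¬ P α.code :=
  (h.2.2 _ (Nat.lt_succ_of_le (le_of_pair_le_right hk)) α.isCode).1 hk

theorem and (hk : (Fml.and α β).code ≤ k) : P (Fml.and α β).code ↔ P α.code ∧ P β.code :=
  ((h.2.2 _ (Nat.lt_succ_of_le (le_of_pair_le_left (le_of_pair_le_right hk))) α.isCode).2 _
    (Nat.lt_succ_of_le (le_of_pair_le_right (le_of_pair_le_right hk))) β.isCode).1 hk

theorem or (hk : (Fml.or α β).code ≤ k) : P (Fml.or α β).code ↔ P α.code ∨ P β.code :=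
  ((h.2.2 _ (Nat.lt_succ_of_le (le_of_pair_le_left (le_of_pair_le_right hk))) α.isCode).2 _
    (Nat.lt_succ_of_le (le_of_pair_le_right (le_of_pair_le_right hk))) β.isCode).2.1 hk

theorem imp (hk : (Fml.imp α β).code ≤ k) : P (Fml.imp α β).code ↔ ¬ P α.code ∨ P β.code :=
  ((h.2.2 _ (Nat.lt_succ_of_le (le_of_pair_le_left (le_of_pair_le_right hk))) α.isCode).2 _
    (Nat.lt_succ_of_le (le_of_pair_le_right (le_of_pair_le_right hk))) β.isCode).2.2 hk

end BoolTable

theorem BoolTable.of_iff {k : ℕ} {s : Kind} {P : ℕ → Prop} {Q : Fml s → Prop}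
    (h : ∀ α : Fml s, α.code ≤ k → (P α.code ↔ Q α)) (htop : Q .top) (hbot : ¬ Q .bot)
    (hneg : ∀ α, Q (.neg α) ↔ ¬ Q α) (hand : ∀ α β, Q (.and α β) ↔ Q α ∧ Q β)
    (hor : ∀ α β, Q (.or α β) ↔ Q α ∨ Q β) (himp : ∀ α β, Q (.imp α β) ↔ ¬ Q α ∨ Q β) :
    BoolTable k s P := by
  refine ⟨fun hk => (h .top hk).2 htop, fun hk => (not_congr (h .bot hk)).2 hbot, ?_⟩
  rintro _ ha ⟨α, rfl⟩
  have hα := h α (Nat.le_of_lt_succ ha)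
  refine ⟨fun hk => by rw [hα, ← hneg]; exact h (.neg α) hk, ?_⟩
  rintro _ hb ⟨β, rfl⟩
  have hβ := h β (Nat.le_of_lt_succ hb)
  rw [hα, hβ, ← hand, ← hor, ← himp]
  exact ⟨h (.and α β), h (.or α β), h (.imp α β)⟩

/-! ### Tables for depth-indexed valuations -/

/-- `A d` and `B d` are the truth tables at depth `d` for formulas of kind `n` and `w`. -/
def IsDepthTable (k : ℕ) (A B : ℕ → ℕ → Prop) : Prop :=
  ∀ d < k + 1, BoolTable k .n (A d) ∧ BoolTable k .w (B d) ∧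
    ∀ l < k + 1, (Nat.pair 1 l ≤ k → B d (Nat.pair 1 l)) ∧ (Nat.pair 2 l ≤ k → B d (Nat.pair 2 l)) ∧
      ∀ a < k + 1,
        (IsCode .n a → Nat.pair 9 (Nat.pair l a) ≤ k →
          (B d (Nat.pair 9 (Nat.pair l a)) ↔ A (d + 1) a)) ∧
        (IsCode .w a → Nat.pair 10 (Nat.pair l a) ≤ k →
          (A d (Nat.pair 10 (Nat.pair l a)) ↔ B (d + 1) a))

theorem NLabel.exists_code (l : ℕ) : ∃ φ : NLabel, φ.code = l :=
  match l with
  | 0 => ⟨.all, rfl⟩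
  | 1 => ⟨.ex, rfl⟩
  | N + 2 => ⟨.var N, rfl⟩

theorem WLabel.exists_code (l : ℕ) : ∃ φ : WLabel, φ.code = l :=
  match l with
  | 0 => ⟨.all, rfl⟩
  | 1 => ⟨.ex, rfl⟩
  | N + 2 => ⟨.var N, rfl⟩

/-- Choice of the table for a kind. -/
def Kind.pick {ι : Sort*} (A B : ι) : Kind → ι
  | .n => A
  | .w => B

/-- Agreement is required up to depth `k + 1` because row `d ≤ k` refers to row `d + 1`. -/
theorem isDepthTable_of_dsat {k : ℕ} {A B : ℕ → ℕ → Prop} {v : ℕ → ℕ → Prop}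
    (h : ∀ {s : Kind} (α : Fml s), α.code ≤ k → ∀ d ≤ k + 1,
      (s.pick A B d α.code ↔ DSat v α d)) : IsDepthTable k A B := by
  have imp : ∀ {s : Kind} (α β : Fml s) d, DSat v (.imp α β) d ↔ ¬ DSat v α d ∨ DSat v β d :=
    fun _ _ _ => imp_iff_not_or
  intro d hd
  refine ⟨.of_iff (Q := fun α => DSat v α d) (fun α hα => h α hα d hd.le) trivial id
    (fun _ => Iff.rfl) (fun _ _ => Iff.rfl) (fun _ _ => Iff.rfl) (fun _ _ => imp _ _ _),
    .of_iff (Q := fun α => DSat v α d) (fun α hα => h α hα d hd.le) trivial id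
    (fun _ => Iff.rfl) (fun _ _ => Iff.rfl) (fun _ _ => Iff.rfl) (fun _ _ => imp _ _ _),
    fun l _ => ⟨fun hk => (h (.incl l) hk d hd.le).2 trivial,
      fun hk => (h (.cont l) hk d hd.le).2 trivial, fun a ha => ⟨?_, ?_⟩⟩⟩
  · rintro ⟨α, rfl⟩ hk
    obtain ⟨φ, rfl⟩ := WLabel.exists_code l
    exact (h (.byW φ α) hk d hd.le).trans (h α (Nat.le_of_lt_succ ha) (d + 1) hd).symm
  · rintro ⟨α, rfl⟩ hk
    obtain ⟨φ, rfl⟩ := NLabel.exists_code l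
    exact (h (.byN φ α) hk d hd.le).trans (h α (Nat.le_of_lt_succ ha) (d + 1) hd).symm

/-- Stripping a label raises the depth by one but lowers the code by more, so `d + α.code ≤ k`
survives the induction and the table is never read below its last constrained row. -/
theorem IsDepthTable.dsat_iff {k : ℕ} {A B : ℕ → ℕ → Prop} (h : IsDepthTable k A B) {s : Kind}
    (α : Fml s) (d : ℕ) (hk : d + α.code ≤ k) :
    DSat (fun p d => A d (Nat.pair 0 p)) α d ↔ s.pick A B d α.code := by
  induction α generalizing d with
  | atom p => exact Iff.rfl
  | incl M =>
    have hM : Nat.pair 1 M ≤ k := by simp only [Fml.code] at hk; omega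
    exact iff_of_true trivial
      (((h d (by omega)).2.2 M (Nat.lt_succ_of_le (le_of_pair_le_right hM))).1 hM)
  | cont M =>
    have hM : Nat.pair 2 M ≤ k := by simp only [Fml.code] at hk; omega
    exact iff_of_true trivial
      (((h d (by omega)).2.2 M (Nat.lt_succ_of_le (le_of_pair_le_right hM))).2.1 hM)
  | @top s =>
    refine iff_of_true trivial ?_
    cases s
    · exact (h d (by omega)).1.1 (by simp only [Fml.code] at hk; omega)
    · exact (h d (by omega)).2.1.1 (by simp only [Fml.code] at hk; omega)
  | @bot s =>
    refine iff_of_false id ?_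
    cases s
    · exact (h d (by omega)).1.2.1 (by simp only [Fml.code] at hk; omega)
    · exact (h d (by omega)).2.1.2.1 (by simp only [Fml.code] at hk; omega)
  | @neg s α ih =>
    have h₁ := Nat.add_le_pair 5 α.code
    simp only [Fml.code] at hk
    refine (not_congr (ih d (by omega))).trans ?_
    cases s
    · exact ((h d (by omega)).1.neg (by simp only [Fml.code]; omega)).symm
    · exact ((h d (by omega)).2.1.neg (by simp only [Fml.code]; omega)).symm
  | @and s α β ih₁ ih₂ =>
    have h₁ := Nat.add_le_pair 6 (Nat.pair α.code β.code)
    have h₂ := Nat.add_le_pair α.code β.code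
    simp only [Fml.code] at hk
    refine (and_congr (ih₁ d (by omega)) (ih₂ d (by omega))).trans ?_
    cases s
    · exact ((h d (by omega)).1.and (by simp only [Fml.code]; omega)).symm
    · exact ((h d (by omega)).2.1.and (by simp only [Fml.code]; omega)).symm
  | @or s α β ih₁ ih₂ =>
    have h₁ := Nat.add_le_pair 7 (Nat.pair α.code β.code)
    have h₂ := Nat.add_le_pair α.code β.code
    simp only [Fml.code] at hk
    refine (or_congr (ih₁ d (by omega)) (ih₂ d (by omega))).trans ?_
    cases s
    · exact ((h d (by omega)).1.or (by simp only [Fml.code]; omega)).symm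
    · exact ((h d (by omega)).2.1.or (by simp only [Fml.code]; omega)).symm
  | @imp s α β ih₁ ih₂ =>
    have h₁ := Nat.add_le_pair 8 (Nat.pair α.code β.code)
    have h₂ := Nat.add_le_pair α.code β.code
    simp only [Fml.code] at hk
    refine imp_iff_not_or.trans
      ((or_congr (not_congr (ih₁ d (by omega))) (ih₂ d (by omega))).trans ?_)
    cases s
    · exact ((h d (by omega)).1.imp (by simp only [Fml.code]; omega)).symm
    · exact ((h d (by omega)).2.1.imp (by simp only [Fml.code]; omega)).symm
  | byW φ α ih =>
    have h₁ := Nat.add_le_pair 9 (Nat.pair φ.code α.code)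
    have h₂ := Nat.add_le_pair φ.code α.code
    simp only [Fml.code] at hk
    exact (ih (d + 1) (by omega)).trans ((((h d (by omega)).2.2 φ.code (by omega)).2.2 α.code
      (by omega)).1 α.isCode (by omega)).symm
  | byN φ α ih =>
    have h₁ := Nat.add_le_pair 10 (Nat.pair φ.code α.code)
    have h₂ := Nat.add_le_pair φ.code α.code
    simp only [Fml.code] at hk
    exact (ih (d + 1) (by omega)).trans ((((h d (by omega)).2.2 φ.code (by omega)).2.2 α.code
      (by omega)).2 α.isCode (by omega)).symm

/-! ### Tables for finite models -/

/-- Inclusion of subsets of `{0, …, m - 1}` given by bitmasks. -/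
def MaskSub (m i j : ℕ) : Prop := ∀ y < m, i.testBit y = true → j.testBit y = true

/-- `A`, `E` and `B` describe a finite model with worlds `0, …, m - 1` and subsets given by
bitmasks: `A x` is the truth table of formulas of `F_n` at `x`, `E x j` says that `j` is a
neighbourhood of `x`, and `B x j` is the truth table of formulas of `F_w` at `(x, j)`. -/
def IsModelTable (m k : ℕ) (A E : ℕ → ℕ → Prop) (B : ℕ → ℕ → ℕ → Prop) : Prop :=
  (∀ x < m, BoolTable k .n (A x) ∧
    (∀ j < 2 ^ m, E x j → BoolTable k .w (B x j) ∧
      (∀ i < 2 ^ m, E x i → MaskSub m i j ∨ MaskSub m j i) ∧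
      ∀ a < k + 1, IsCode .n a →
        (Nat.pair 9 (Nat.pair 0 a) ≤ k →
          (B x j (Nat.pair 9 (Nat.pair 0 a)) ↔ ∀ y < m, j.testBit y = true → A y a)) ∧
        (Nat.pair 9 (Nat.pair 1 a) ≤ k →
          (B x j (Nat.pair 9 (Nat.pair 1 a)) ↔ ∃ y < m, j.testBit y = true ∧ A y a))) ∧
    ∀ a < k + 1, IsCode .w a →
      (Nat.pair 10 (Nat.pair 0 a) ≤ k →
        (A x (Nat.pair 10 (Nat.pair 0 a)) ↔ ∀ j < 2 ^ m, E x j → B x j a)) ∧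
      (Nat.pair 10 (Nat.pair 1 a) ≤ k →
        (A x (Nat.pair 10 (Nat.pair 1 a)) ↔ ∃ j < 2 ^ m, E x j ∧ B x j a))) ∧
  (∀ z < k + 1, ∃ y < m, ∀ x < m, ∀ j < 2 ^ m, E x j → ∀ a < k + 1, IsCode .n a →
    Nat.pair 9 (Nat.pair (z + 2) a) ≤ k →
      (B x j (Nat.pair 9 (Nat.pair (z + 2) a)) ↔ j.testBit y = true ∧ A y a)) ∧
  (∀ N < k + 1, ∃ i < 2 ^ m, (∃ y < m, i.testBit y = true) ∧ ∀ x < m,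
    (∀ a < k + 1, IsCode .w a → Nat.pair 10 (Nat.pair (N + 2) a) ≤ k →
      (A x (Nat.pair 10 (Nat.pair (N + 2) a)) ↔ E x i ∧ B x i a)) ∧
    ∀ j < 2 ^ m, E x j →
      (Nat.pair 1 N ≤ k → (B x j (Nat.pair 1 N) ↔ E x i ∧ MaskSub m i j)) ∧
      (Nat.pair 2 N ≤ k → (B x j (Nat.pair 2 N) ↔ E x i ∧ MaskSub m j i)))

section ModelTable

variable {W : Type u} {m k : ℕ} (e : W ≃ Fin m)

/-- The set of worlds given by a bitmask. -/
def maskSet (j : ℕ) : Set W := {w | j.testBit (e w) = true}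

theorem exists_maskSet_eq (S : Set W) : ∃ j < 2 ^ m, maskSet e j = S := by
  obtain ⟨j, hj, h⟩ := exists_bitmask m fun i => ∃ w ∈ S, (e w : ℕ) = i
  refine ⟨j, hj, Set.ext fun w => (h _ (e w).2).trans ⟨?_, fun hw => ⟨w, hw, rfl⟩⟩⟩
  rintro ⟨w', hw', h⟩
  exact e.injective (Fin.ext h) ▸ hw'

theorem exists_world_eq {x : ℕ} (hx : x < m) : ∃ w, (e w : ℕ) = x :=
  ⟨e.symm ⟨x, hx⟩, by simp⟩

theorem maskSub_iff {i j : ℕ} : MaskSub m i j ↔ maskSet e i ⊆ maskSet e j := by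
  refine ⟨fun h w hw => h _ (e w).2 hw, fun h y hy hi => ?_⟩
  obtain ⟨w, rfl⟩ := exists_world_eq e hy
  exact h hi

theorem maskSet_inj {i j : ℕ} (hi : i < 2 ^ m) (hj : j < 2 ^ m) (h : maskSet e i = maskSet e j) :
    i = j := by
  refine Nat.eq_of_testBit_eq fun y => ?_
  by_cases hy : y < m
  · obtain ⟨w, rfl⟩ := exists_world_eq e hy
    exact Bool.eq_iff_iff.2 (Set.ext_iff.1 h w)
  · have := Nat.pow_le_pow_right two_pos (not_lt.1 hy)
    rw [Nat.testBit_lt_two_pow (hi.trans_le this), Nat.testBit_lt_two_pow (hj.trans_le this)]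

theorem isModelTable_of_frame (F : Frame W) (σ : Assignment W) {A E : ℕ → ℕ → Prop}
    {B : ℕ → ℕ → ℕ → Prop}
    (hA : ∀ (α : Fml .n), α.code ≤ k → ∀ x, A (e x) α.code ↔ Sat F σ α x)
    (hE : ∀ x, ∀ j < 2 ^ m, E (e x) j ↔ maskSet e j ∈ F.nest x)
    (hB : ∀ (α : Fml .w), α.code ≤ k → ∀ x, ∀ j < 2 ^ m, ∀ h : maskSet e j ∈ F.nest x,
      B (e x) j α.code ↔ Sat F σ α ⟨x, maskSet e j, h⟩) :
    IsModelTable m k A E B := by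
  refine ⟨fun x hx => ?_, fun z hz => ?_, fun N hN => ?_⟩
  · obtain ⟨x, rfl⟩ := exists_world_eq e hx
    refine ⟨.of_iff (Q := fun α => Sat F σ α x) (fun α hα => hA α hα x) trivial id
      (fun _ => Iff.rfl) (fun _ _ => Iff.rfl) (fun _ _ => Iff.rfl) (fun _ _ => Iff.rfl),
      fun j hj hx => ?_, ?_⟩
    · have hS := (hE x j hj).1 hx
      refine ⟨.of_iff (Q := fun α => Sat F σ α ⟨x, maskSet e j, hS⟩)
        (fun α hα => hB α hα x j hj hS) trivial id
        (fun _ => Iff.rfl) (fun _ _ => Iff.rfl) (fun _ _ => Iff.rfl) (fun _ _ => Iff.rfl),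
        fun i hi hx' => ?_, ?_⟩
      · rw [maskSub_iff e, maskSub_iff e]
        exact F.nested x _ ((hE x i hi).1 hx') _ hS
      · rintro _ ha ⟨α, rfl⟩
        have hα := hA α (Nat.le_of_lt_succ ha)
        refine ⟨fun hk => (hB (.byW .all α) hk x j hj hS).trans ⟨fun h y hy hjy => ?_,
          fun h w hw => (hα w).1 (h _ (e w).2 hw)⟩,
          fun hk => (hB (.byW .ex α) hk x j hj hS).trans ⟨fun ⟨w, hw, h⟩ =>
            ⟨_, (e w).2, hw, (hα w).2 h⟩, fun ⟨y, hy, hjy, h⟩ => ?_⟩⟩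
        · obtain ⟨w, rfl⟩ := exists_world_eq e hy
          exact (hα w).2 (h w hjy)
        · obtain ⟨w, rfl⟩ := exists_world_eq e hy
          exact ⟨w, hjy, (hα w).1 h⟩
    · rintro _ ha ⟨α, rfl⟩
      have hα := hB α (Nat.le_of_lt_succ ha) x
      refine ⟨fun hk => (hA (.byN .all α) hk x).trans ⟨fun h j hj hx => ?_, fun h S hS => ?_⟩,
        fun hk => (hA (.byN .ex α) hk x).trans ⟨fun ⟨S, hS, h⟩ => ?_, fun ⟨j, hj, hx, h⟩ => ?_⟩⟩
      · exact (hα j hj ((hE x j hj).1 hx)).2 (h _ _)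
      · obtain ⟨j, hj, rfl⟩ := exists_maskSet_eq e S
        exact (hα j hj hS).1 (h j hj ((hE x j hj).2 hS))
      · obtain ⟨j, hj, rfl⟩ := exists_maskSet_eq e S
        exact ⟨j, hj, (hE x j hj).2 hS, (hα j hj hS).2 h⟩
      · have hS := (hE x j hj).1 hx
        exact ⟨_, hS, (hα j hj hS).1 h⟩
  · refine ⟨_, (e (σ.world z)).2, fun x hx j hj h => ?_⟩
    obtain ⟨x, rfl⟩ := exists_world_eq e hx
    have hS := (hE x j hj).1 h
    rintro _ ha ⟨α, rfl⟩ hk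
    exact (hB (.byW (.var z) α) hk x j hj hS).trans
      (and_congr Iff.rfl (hA α (Nat.le_of_lt_succ ha) _).symm)
  · obtain ⟨i, hi, h⟩ := exists_maskSet_eq e (σ.nbhd N)
    refine ⟨i, hi, ?_, fun x hx => ?_⟩
    · obtain ⟨w, hw⟩ := σ.nbhd_nonempty N
      rw [← h] at hw
      exact ⟨_, (e w).2, hw⟩
    · obtain ⟨x, rfl⟩ := exists_world_eq e hx
      constructor
      · rintro _ ha ⟨α, rfl⟩ hk
        refine (hA (.byN (.var N) α) hk x).trans ?_
        have hα := hB α (Nat.le_of_lt_succ ha) x i hi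
        rw [hE x i hi]
        simp only [h] at hα ⊢
        exact ⟨fun ⟨hS, hs⟩ => ⟨hS, (hα hS).2 hs⟩, fun ⟨hS, hs⟩ => ⟨hS, (hα hS).1 hs⟩⟩
      · intro j hj hx
        have hS := (hE x j hj).1 hx
        refine ⟨fun hk => (hB (.incl N) hk x j hj hS).trans ?_,
          fun hk => (hB (.cont N) hk x j hj hS).trans ?_⟩
        · rw [hE x i hi, maskSub_iff e, h]; rfl
        · rw [hE x i hi, maskSub_iff e, h]; rfl

/-- The worlds, neighbourhoods and atoms are read off the table, and the variables denote the
witnesses it asserts. The table conditions are the clauses of satisfaction, so the remaining entries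
agree by induction. -/
theorem IsModelTable.exists_frame {A E : ℕ → ℕ → Prop} {B : ℕ → ℕ → ℕ → Prop}
    (h : IsModelTable m k A E B) :
    ∃ (F : Frame W) (σ : Assignment W), ∀ φ : Fml .n, φ.code ≤ k → ∀ x,
      Sat F σ φ x ↔ A (e x) φ.code := by
  obtain ⟨h₁, h₂, h₃⟩ := h
  choose! g hg h₂ using h₂
  choose! f hf hne h₃ using h₃
  have pr : ∀ {a b}, Nat.pair a b ≤ k → b < k + 1 := fun h => Nat.lt_succ_of_le (le_of_pair_le_right h)
  have pl : ∀ {a b}, Nat.pair a b ≤ k → a < k + 1 := fun h => Nat.lt_succ_of_le (le_of_pair_le_left h)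
  let F : Frame W :=
    { nest x := {S | ∃ j < 2 ^ m, E (e x) j ∧ maskSet e j = S}
      nested := by
        rintro x _ ⟨i, hi, hx, rfl⟩ _ ⟨j, hj, hx', rfl⟩
        rw [← maskSub_iff e, ← maskSub_iff e]
        exact ((h₁ _ (e x).2).2.1 j hj hx').2.1 i hi hx
      val p := {x | A (e x) (Nat.pair 0 p)} }
  let σ : Assignment W :=
    -- Witnesses exist only for variables up to `k`; larger ones do not occur in the formulas
    -- considered and are clipped to `k`.
    { world z := e.symm ⟨g (min z k), hg _ (by omega)⟩
      nbhd N := maskSet e (f (min N k))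
      nbhd_nonempty N := by
        obtain ⟨y, hy, h⟩ := hne (min N k) (by omega)
        obtain ⟨w, rfl⟩ := exists_world_eq e hy
        exact ⟨w, h⟩ }
  have hσ : ∀ N < k + 1, σ.nbhd N = maskSet e (f N) := fun N hN => by
    simp only [σ, min_eq_left (Nat.le_of_lt_succ hN)]
  have hσ' : ∀ z < k + 1, (e (σ.world z) : ℕ) = g z := fun z hz => by
    simp [σ, min_eq_left (Nat.le_of_lt_succ hz)]
  have hF : ∀ x, ∀ j < 2 ^ m, maskSet e j ∈ F.nest x ↔ E (e x) j := fun x j hj =>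
    ⟨fun ⟨i, hi, hx, h⟩ => maskSet_inj e hi hj h ▸ hx, fun hx => ⟨j, hj, hx, rfl⟩⟩
  -- The induction alternates between the two kinds, so the claim is stated for both at once.
  let R : {s : Kind} → Fml s → Prop := fun {s} => match s with
    | .n => fun α => ∀ x, Sat F σ α x ↔ A (e x) α.code
    | .w => fun α => ∀ x, ∀ j < 2 ^ m, ∀ h : maskSet e j ∈ F.nest x,
        Sat F σ α ⟨x, maskSet e j, h⟩ ↔ B (e x) j α.code
  have table : ∀ x, BoolTable k .n (A (e x)) := fun x => (h₁ _ (e x).2).1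
  have table' : ∀ x, ∀ j < 2 ^ m, maskSet e j ∈ F.nest x → BoolTable k .w (B (e x) j) :=
    fun x j hj h => ((h₁ _ (e x).2).2.1 j hj ((hF x j hj).1 h)).1
  suffices key : ∀ {s : Kind} (α : Fml s), α.code ≤ k → R α from ⟨F, σ, key⟩
  intro s α hk
  induction α with
  | atom p => exact fun x => Iff.rfl
  | incl M =>
    intro x j hj h
    have hM : M < k + 1 := pr hk
    refine Iff.trans ?_ (((h₃ M hM _ (e x).2).2 j hj ((hF x j hj).1 h)).1 hk).symm
    rw [← hF x _ (hf M hM), maskSub_iff e, ← hσ M hM]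
    rfl
  | cont M =>
    intro x j hj h
    have hM : M < k + 1 := pr hk
    refine Iff.trans ?_ (((h₃ M hM _ (e x).2).2 j hj ((hF x j hj).1 h)).2 hk).symm
    rw [← hF x _ (hf M hM), maskSub_iff e, ← hσ M hM]
    rfl
  | @top s =>
    cases s
    · exact fun x => iff_of_true trivial ((table x).1 hk)
    · exact fun x j hj h => iff_of_true trivial ((table' x j hj h).1 hk)
  | @bot s =>
    cases s
    · exact fun x => iff_of_false id ((table x).2.1 hk)
    · exact fun x j hj h => iff_of_false id ((table' x j hj h).2.1 hk)
  | @neg s α ih =>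
    have ih := ih (le_of_pair_le_right hk)
    cases s
    · exact fun x => (not_congr (ih x)).trans ((table x).neg hk).symm
    · exact fun x j hj h => (not_congr (ih x j hj h)).trans ((table' x j hj h).neg hk).symm
  | @and s α β ih₁ ih₂ =>
    have ih₁ := ih₁ (le_of_pair_le_left (le_of_pair_le_right hk))
    have ih₂ := ih₂ (le_of_pair_le_right (le_of_pair_le_right hk))
    cases s
    · exact fun x => (and_congr (ih₁ x) (ih₂ x)).trans ((table x).and hk).symm
    · exact fun x j hj h => (and_congr (ih₁ x j hj h) (ih₂ x j hj h)).trans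
        ((table' x j hj h).and hk).symm
  | @or s α β ih₁ ih₂ =>
    have ih₁ := ih₁ (le_of_pair_le_left (le_of_pair_le_right hk))
    have ih₂ := ih₂ (le_of_pair_le_right (le_of_pair_le_right hk))
    cases s
    · exact fun x => (or_congr (ih₁ x) (ih₂ x)).trans ((table x).or hk).symm
    · exact fun x j hj h => (or_congr (ih₁ x j hj h) (ih₂ x j hj h)).trans
        ((table' x j hj h).or hk).symm
  | @imp s α β ih₁ ih₂ =>
    have ih₁ := ih₁ (le_of_pair_le_left (le_of_pair_le_right hk))
    have ih₂ := ih₂ (le_of_pair_le_right (le_of_pair_le_right hk))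
    cases s
    · exact fun x => (or_congr (not_congr (ih₁ x)) (ih₂ x)).trans ((table x).imp hk).symm
    · exact fun x j hj h => (or_congr (not_congr (ih₁ x j hj h)) (ih₂ x j hj h)).trans
        ((table' x j hj h).imp hk).symm
  | byW φ α ih =>
    have hα : α.code < k + 1 := pr (le_of_pair_le_right hk)
    have ih := ih (Nat.le_of_lt_succ hα)
    intro x j hj h
    have hx := (hF x j hj).1 h
    have h₁ := ((h₁ _ (e x).2).2.1 j hj hx).2.2 _ hα α.isCode
    cases φ with
    | all =>
      refine Iff.trans ⟨fun h y hy hjy => ?_, fun h w hw => (ih w).2 (h _ (e w).2 hw)⟩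
        (h₁.1 hk).symm
      obtain ⟨w, rfl⟩ := exists_world_eq e hy
      exact (ih w).1 (h w hjy)
    | ex =>
      refine Iff.trans ⟨fun ⟨w, hw, h⟩ => ⟨_, (e w).2, hw, (ih w).1 h⟩,
        fun ⟨y, hy, hjy, h⟩ => ?_⟩ (h₁.2 hk).symm
      obtain ⟨w, rfl⟩ := exists_world_eq e hy
      exact ⟨w, hjy, (ih w).2 h⟩
    | var z =>
      have hz : z < k + 1 := by
        have := le_of_pair_le_left (le_of_pair_le_right hk)
        simp only [WLabel.code] at this
        omega
      refine Iff.trans ?_ (h₂ z hz _ (e x).2 j hj hx _ hα α.isCode hk).symm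
      rw [← hσ' z hz]
      exact and_congr Iff.rfl (ih _)
  | byN φ α ih =>
    have hα : α.code < k + 1 := pr (le_of_pair_le_right hk)
    have ih := ih (Nat.le_of_lt_succ hα)
    intro x
    have h₁ := (h₁ _ (e x).2).2.2 _ hα α.isCode
    cases φ with
    | all =>
      refine Iff.trans ⟨fun h j hj hx => (ih x j hj _).1 (h _ ((hF x j hj).2 hx)), ?_⟩
        (h₁.1 hk).symm
      rintro h _ ⟨j, hj, hx, rfl⟩
      exact (ih x j hj _).2 (h j hj hx)
    | ex =>
      refine Iff.trans ⟨?_, fun ⟨j, hj, hx, h⟩ => ⟨_, (hF x j hj).2 hx, (ih x j hj _).2 h⟩⟩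
        (h₁.2 hk).symm
      rintro ⟨_, ⟨j, hj, hx, rfl⟩, h⟩
      exact ⟨j, hj, hx, (ih x j hj _).1 h⟩
    | var N =>
      have hN : N < k + 1 := by
        have := le_of_pair_le_left (le_of_pair_le_right hk)
        simp only [NLabel.code] at this
        omega
      refine Iff.trans ?_ ((h₃ N hN _ (e x).2).1 _ hα α.isCode hk).symm
      have ih := ih x (f N) (hf N hN)
      rw [← hF x _ (hf N hN)]
      simp only [Sat, hσ N hN]
      exact ⟨fun ⟨hS, hs⟩ => ⟨hS, (ih hS).1 hs⟩, fun ⟨hS, hs⟩ => ⟨hS, (ih hS).2 hs⟩⟩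

end ModelTable

/-! ### Primitive recursive predicates with bounded quantifiers -/

section Primrec

variable {α : Type*} [Primcodable α] {f g : α → ℕ} {p q : α → Prop}

theorem primrecPred_forall_lt {P : ℕ → α → Prop} (hf : Primrec f)
    (hP : PrimrecPred fun x : ℕ × α => P x.1 x.2) : PrimrecPred fun a => ∀ x < f a, P x a := by
  have h : PrimrecRel P := hP
  have := (PrimrecRel.forall_mem_list h).comp (Primrec.list_range.comp hf) Primrec.id
  exact this.of_eq (by simp)

theorem primrecPred_exists_lt {P : ℕ → α → Prop} (hf : Primrec f)
    (hP : PrimrecPred fun x : ℕ × α => P x.1 x.2) : PrimrecPred fun a => ∃ x < f a, P x a := by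
  have h : PrimrecRel P := hP
  have := (PrimrecRel.exists_mem_list h).comp (Primrec.list_range.comp hf) Primrec.id
  exact this.of_eq (by simp)

theorem primrecPred_imp (hp : PrimrecPred p) (hq : PrimrecPred q) :
    PrimrecPred fun a => p a → q a :=
  (hp.not.or hq).of_eq fun _ => imp_iff_not_or.symm

theorem primrecPred_iff (hp : PrimrecPred p) (hq : PrimrecPred q) :
    PrimrecPred fun a => p a ↔ q a :=
  ((primrecPred_imp hp hq).and (primrecPred_imp hq hp)).of_eq fun _ => iff_iff_implies_and_implies.symm

theorem primrecPred_le (hf : Primrec f) (hg : Primrec g) : PrimrecPred fun a => f a ≤ g a :=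
  Primrec.nat_le.comp hf hg

theorem primrecPred_eq (hf : Primrec f) (hg : Primrec g) : PrimrecPred fun a => f a = g a :=
  Primrec.eq.comp hf hg

theorem primrec_pair (hf : Primrec f) (hg : Primrec g) : Primrec fun a => Nat.pair (f a) (g a) :=
  Primrec₂.natPair.comp hf hg

theorem primrec_add (hf : Primrec f) (hg : Primrec g) : Primrec fun a => f a + g a :=
  Primrec.nat_add.comp hf hg

theorem primrec_mul (hf : Primrec f) (hg : Primrec g) : Primrec fun a => f a * g a :=
  Primrec.nat_mul.comp hf hg

theorem primrec_pow (hf : Primrec f) (hg : Primrec g) : Primrec fun a => f a ^ g a := by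
  have : Primrec₂ fun b n : ℕ => b ^ n :=
    (Primrec.nat_rec (f := fun _ => 1) (g := fun (b : ℕ) (p : ℕ × ℕ) => p.2 * b) (.const _)
      (Primrec.nat_mul.comp (Primrec.snd.comp Primrec.snd) Primrec.fst)).of_eq fun b n => by
        induction n with
        | zero => rfl
        | succ n ih => rw [pow_succ, ← ih]
  exact this.comp hf hg

theorem primrecPred_testBit (hf : Primrec f) (hg : Primrec g) :
    PrimrecPred fun a => (f a).testBit (g a) = true :=
  (Primrec.eq.comp (Primrec.nat_mod.comp (Primrec.nat_div.comp hf (primrec_pow (.const 2) hg))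
    (.const 2)) (.const 1)).of_eq fun a => by simp [Nat.testBit_eq_decide_div_mod_eq]

theorem primrec_self : Primrec fun a : α => a := Primrec.id

theorem primrec_fst {β γ : Type*} [Primcodable β] [Primcodable γ] {f : α → β × γ}
    (hf : Primrec f) : Primrec fun a => (f a).1 := Primrec.fst.comp hf

theorem primrec_snd {β γ : Type*} [Primcodable β] [Primcodable γ] {f : α → β × γ}
    (hf : Primrec f) : Primrec fun a => (f a).2 := Primrec.snd.comp hf

end Primrec

theorem pair_le_pair {a b c d : ℕ} (h₁ : a ≤ c) (h₂ : b ≤ d) : Nat.pair a b ≤ Nat.pair c d := by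
  refine le_trans (b := Nat.pair c b) ?_ ?_
  · rcases h₁.eq_or_lt with rfl | h
    exacts [le_rfl, (Nat.pair_lt_pair_left b h).le]
  · rcases h₂.eq_or_lt with rfl | h
    exacts [le_rfl, (Nat.pair_lt_pair_right c h).le]

/-! ### Goedel numbers of formulas are primitive recursive -/

/-- `c` is, by its outermost symbol, the Goedel number of a formula of kind `s`, provided that
`G` holds for the Goedel numbers of its immediate subformulas. -/
def CodeStep (s : Kind) (G : Kind → ℕ → Prop) (c : ℕ) : Prop :=
  c = Nat.pair 3 0 ∨ c = Nat.pair 4 0 ∨ (∃ a < c, G s a ∧ c = Nat.pair 5 a) ∨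
  (∃ a < c, ∃ b < c, G s a ∧ G s b ∧
    (c = Nat.pair 6 (Nat.pair a b) ∨ c = Nat.pair 7 (Nat.pair a b) ∨
      c = Nat.pair 8 (Nat.pair a b))) ∨
  match s with
  | .n => (∃ p < c + 1, c = Nat.pair 0 p) ∨
      ∃ l < c, ∃ a < c, G .w a ∧ c = Nat.pair 10 (Nat.pair l a)
  | .w => (∃ N < c + 1, c = Nat.pair 1 N ∨ c = Nat.pair 2 N) ∨
      ∃ l < c, ∃ a < c, G .n a ∧ c = Nat.pair 9 (Nat.pair l a)

theorem codeStep_isCode {s : Kind} (α : Fml s) : CodeStep s IsCode α.code := by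
  have h₁ : ∀ {t a : ℕ}, a < Nat.pair (t + 1) a := fun {t a} =>
    lt_of_lt_of_le (by omega) (Nat.add_le_pair (t + 1) a)
  have h₂ : ∀ {t a b : ℕ}, a < Nat.pair (t + 1) (Nat.pair a b) := fun {t a b} =>
    (Nat.left_le_pair a b).trans_lt h₁
  have h₃ : ∀ {t a b : ℕ}, b < Nat.pair (t + 1) (Nat.pair a b) := fun {t a b} =>
    (Nat.right_le_pair a b).trans_lt h₁
  cases α with
  -- Tag `0` gives no strict decrease: `Nat.pair 0 0 = 0`, hence the bound `c + 1` for atoms.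
  | atom p => exact .inr (.inr (.inr (.inr (.inl ⟨p, Nat.lt_succ_of_le (Nat.right_le_pair _ _), rfl⟩))))
  | incl N => exact .inr (.inr (.inr (.inr (.inl ⟨N, h₁.le.trans_lt (Nat.lt_succ_self _), .inl rfl⟩))))
  | cont N => exact .inr (.inr (.inr (.inr (.inl ⟨N, h₁.le.trans_lt (Nat.lt_succ_self _), .inr rfl⟩))))
  | top => exact .inl rfl
  | bot => exact .inr (.inl rfl)
  | neg α => exact .inr (.inr (.inl ⟨_, h₁, α.isCode, rfl⟩))
  | and α β =>
    exact .inr (.inr (.inr (.inl ⟨_, h₂, _, h₃, α.isCode, β.isCode, .inl rfl⟩)))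
  | or α β =>
    exact .inr (.inr (.inr (.inl ⟨_, h₂, _, h₃, α.isCode, β.isCode, .inr (.inl rfl)⟩)))
  | imp α β =>
    exact .inr (.inr (.inr (.inl ⟨_, h₂, _, h₃, α.isCode, β.isCode, .inr (.inr rfl)⟩)))
  | byW φ α => exact .inr (.inr (.inr (.inr (.inr ⟨_, h₂, _, h₃, α.isCode, rfl⟩))))
  | byN φ α => exact .inr (.inr (.inr (.inr (.inr ⟨_, h₂, _, h₃, α.isCode, rfl⟩))))

theorem CodeStep.isCode {s : Kind} {G : Kind → ℕ → Prop} {c : ℕ} (h : CodeStep s G c)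
    (hG : ∀ t, ∀ a < c, G t a → IsCode t a) : IsCode s c := by
  rcases h with rfl | rfl | ⟨a, ha, ga, rfl⟩ | ⟨a, ha, b, hb, ga, gb, hc⟩ | h
  · exact ⟨.top, rfl⟩
  · exact ⟨.bot, rfl⟩
  · obtain ⟨α, rfl⟩ := hG _ a ha ga
    exact ⟨.neg α, rfl⟩
  · obtain ⟨α, rfl⟩ := hG _ a ha ga
    obtain ⟨β, rfl⟩ := hG _ b hb gb
    rcases hc with rfl | rfl | rfl
    exacts [⟨.and α β, rfl⟩, ⟨.or α β, rfl⟩, ⟨.imp α β, rfl⟩]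
  · cases s with
    | n =>
      rcases h with ⟨p, -, rfl⟩ | ⟨l, -, a, ha, ga, rfl⟩
      · exact ⟨.atom p, rfl⟩
      · obtain ⟨α, rfl⟩ := hG _ a ha ga
        obtain ⟨φ, rfl⟩ := NLabel.exists_code l
        exact ⟨.byN φ α, rfl⟩
    | w =>
      rcases h with ⟨N, -, rfl | rfl⟩ | ⟨l, -, a, ha, ga, rfl⟩
      · exact ⟨.incl N, rfl⟩
      · exact ⟨.cont N, rfl⟩
      · obtain ⟨α, rfl⟩ := hG _ a ha ga
        obtain ⟨φ, rfl⟩ := WLabel.exists_code l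
        exact ⟨.byW φ α, rfl⟩

theorem CodeStep.mono {s : Kind} {G G' : Kind → ℕ → Prop} {c : ℕ} (h : CodeStep s G c)
    (hG : ∀ t, ∀ a < c, G t a → G' t a) : CodeStep s G' c := by
  refine h.imp_right (Or.imp_right (Or.imp ?_ (Or.imp ?_ ?_)))
  · exact fun ⟨a, ha, ga, h⟩ => ⟨a, ha, hG _ a ha ga, h⟩
  · exact fun ⟨a, ha, b, hb, ga, gb, h⟩ => ⟨a, ha, b, hb, hG _ a ha ga, hG _ b hb gb, h⟩
  · cases s
    · exact Or.imp_right fun ⟨l, hl, a, ha, ga, h⟩ => ⟨l, hl, a, ha, hG _ a ha ga, h⟩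
    · exact Or.imp_right fun ⟨l, hl, a, ha, ga, h⟩ => ⟨l, hl, a, ha, hG _ a ha ga, h⟩

/-- The predicate on kinds and numbers given by a bitmask. -/
def kindMask (t : ℕ) (s : Kind) (c : ℕ) : Prop := t.testBit (Nat.pair (s.pick 0 1) c) = true

/-- The bitmask is a certificate: every number marked in it must be justified by smaller marked
numbers, so by strong induction only genuine codes are marked. Both kinds are marked together
because labels switch between them. -/
theorem isCode_iff (s : Kind) (k : ℕ) : IsCode s k ↔
    ∃ t < 2 ^ Nat.pair 1 (k + 1), (∀ c < k + 1, (kindMask t .n c → CodeStep .n (kindMask t) c) ∧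
      (kindMask t .w c → CodeStep .w (kindMask t) c)) ∧ kindMask t s k := by
  constructor
  · intro hk
    obtain ⟨t, ht, h⟩ := exists_bitmask (Nat.pair 1 (k + 1)) fun i => ∃ (s : Kind) (c : ℕ),
      Nat.pair (s.pick 0 1) c = i ∧ IsCode s c
    have key : ∀ s, ∀ c < k + 1, kindMask t s c ↔ IsCode s c := by
      intro s c hc
      refine (h _ ((Nat.pair_lt_pair_right _ hc).trans_le (pair_le_pair ?_ le_rfl))).trans
        ⟨?_, fun hc => ⟨s, c, rfl, hc⟩⟩
      · cases s <;> simp [Kind.pick]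
      · rintro ⟨s', c', e, h⟩
        obtain ⟨e, rfl⟩ := Nat.pair_eq_pair.1 e
        cases s <;> cases s' <;> simp_all [Kind.pick]
    have step : ∀ s, ∀ c < k + 1, kindMask t s c → CodeStep s (kindMask t) c := by
      intro s c hc h
      obtain ⟨α, rfl⟩ := (key s c hc).1 h
      exact (codeStep_isCode α).mono fun s a ha => (key s a (ha.trans hc)).2
    exact ⟨t, ht, fun c hc => ⟨step _ c hc, step _ c hc⟩, (key s k (Nat.lt_succ_self k)).2 hk⟩
  · rintro ⟨t, -, h, hk⟩
    have : ∀ c < k + 1, ∀ s, kindMask t s c → IsCode s c := by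
      intro c
      induction c using Nat.strong_induction_on with
      | _ c ih =>
        intro hc s hs
        have : CodeStep s (kindMask t) c := by
          cases s
          exacts [(h c hc).1 hs, (h c hc).2 hs]
        exact this.isCode fun s' a ha => ih a ha (ha.trans hc) s'
    exact this k (Nat.lt_succ_self k) s hk

theorem primrecPred_isCode_self (s : Kind) : PrimrecPred (IsCode s) := by
  refine PrimrecPred.of_eq ?_ fun k => (isCode_iff s k).symm
  simp only [CodeStep, kindMask, Kind.pick]
  -- The unfolded condition is built from bounded quantifiers, connectives, arithmetic and bit
  -- tests, so closure lemmas chosen by the outermost symbol finish it.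
  repeat' with_reducible first
    | exact Primrec.const _
    | exact primrec_self
    | apply primrecPred_forall_lt
    | apply primrecPred_exists_lt
    | apply PrimrecPred.and
    | apply PrimrecPred.or
    | apply primrecPred_testBit
    | apply primrecPred_eq
    | apply primrecPred_imp
    | apply primrec_pair
    | apply primrec_add
    | apply primrec_pow
    | apply primrec_fst
    | apply primrec_snd

theorem primrecPred_isCode {α : Type*} [Primcodable α] {f : α → ℕ} (s : Kind) (hf : Primrec f) :
    PrimrecPred fun a => IsCode s (f a) :=
  (primrecPred_isCode_self s).comp hf

/-! ### Decidability of provability -/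

/-- The table for formulas of kind `s` at depth `d` given by a bitmask. -/
def depthMask (t : ℕ) (s : Kind) (d c : ℕ) : Prop :=
  t.testBit (Nat.pair (s.pick 0 1) (Nat.pair d c)) = true

/-- A refuting valuation matters only at depths up to `φ.code + 1` and codes up to `φ.code`, so its
truth table fits into the bits of a number below the stated bound. Conversely the atom entries of a
correct table define a refuting valuation. -/
theorem provable_iff_table (φ : Fml .n) : Provable φ ↔
    ¬ ∃ t < 2 ^ Nat.pair 1 (Nat.pair (φ.code + 1) (φ.code + 1)),
      IsDepthTable φ.code (depthMask t .n) (depthMask t .w) ∧ ¬ depthMask t .n 0 φ.code := by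
  rw [provable_iff_dsat, ← not_exists_not, not_iff_not]
  constructor
  · rintro ⟨v, hv⟩
    obtain ⟨t, ht, h⟩ := exists_bitmask (Nat.pair 1 (Nat.pair (φ.code + 1) (φ.code + 1)))
      fun i => ∃ (s : Kind) (d : ℕ) (α : Fml s),
        Nat.pair (s.pick 0 1) (Nat.pair d α.code) = i ∧ DSat v α d
    have key : ∀ {s : Kind} (α : Fml s), α.code ≤ φ.code → ∀ d ≤ φ.code + 1,
        (depthMask t s d α.code ↔ DSat v α d) := by
      intro s α hα d hd
      refine (h _ ?_).trans ⟨?_, fun hs => ⟨s, d, α, rfl, hs⟩⟩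
      · refine (pair_le_pair (c := 1) (by cases s <;> simp [Kind.pick]) le_rfl).trans_lt
          (Nat.pair_lt_pair_right _ ?_)
        exact (pair_le_pair hd le_rfl).trans_lt (Nat.pair_lt_pair_right _ (Nat.lt_succ_of_le hα))
      · rintro ⟨s', d', β, e, hs⟩
        obtain ⟨e₁, e⟩ := Nat.pair_eq_pair.1 e
        obtain ⟨rfl, e₂⟩ := Nat.pair_eq_pair.1 e
        obtain rfl : s = s' := by cases s <;> cases s' <;> simp_all [Kind.pick]
        exact Fml.code_injective e₂ ▸ hs
    refine ⟨t, ht, isDepthTable_of_dsat (v := v) fun {s} α hα d hd => ?_,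
      (not_congr (key φ le_rfl 0 (Nat.zero_le _))).2 hv⟩
    rw [← key α hα d hd]
    cases s <;> rfl
  · rintro ⟨t, -, h, hn⟩
    exact ⟨_, (not_congr (h.dsat_iff φ 0 (Nat.zero_add _).le)).2 hn⟩

theorem primrecPred_depthTable : PrimrecPred fun k : ℕ =>
    ∃ t < 2 ^ Nat.pair 1 (Nat.pair (k + 1) (k + 1)),
      IsDepthTable k (depthMask t .n) (depthMask t .w) ∧ ¬ depthMask t .n 0 k := by
  simp only [IsDepthTable, BoolTable, depthMask, Kind.pick]
  repeat' with_reducible first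
    | exact Primrec.const _
    | exact primrec_self
    | apply primrecPred_forall_lt
    | apply primrecPred_exists_lt
    | apply PrimrecPred.and
    | apply PrimrecPred.or
    | apply primrecPred_testBit
    | apply primrecPred_isCode
    | apply primrecPred_le
    | apply primrecPred_iff
    | apply PrimrecPred.not
    | apply primrecPred_imp
    | apply primrec_pair
    | apply primrec_add
    | apply primrec_pow
    | apply primrec_fst
    | apply primrec_snd

theorem decidableSet_of_primrecPred {s : Kind} {P : Fml s → Prop} {Q : ℕ → Prop}
    (hQ : PrimrecPred Q) (h : ∀ φ, P φ ↔ ¬ Q φ.code) : DecidableSet P := by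
  refine (((primrecPred_isCode_self s).and hQ.not).computablePred).of_eq fun k => ⟨?_, ?_⟩
  · rintro ⟨⟨φ, rfl⟩, hq⟩
    exact ⟨φ, rfl, (h φ).2 hq⟩
  · rintro ⟨φ, rfl, hφ⟩
    exact ⟨φ.isCode, (h φ).1 hφ⟩

/-! ### Decidability of validity -/

/-- The bound on the number of worlds of a countermodel. -/
def worldBound (k : ℕ) : ℕ := 2 * 8 ^ (k + 1)

/-- The truth table at worlds given by a bitmask. -/
def maskA (t x c : ℕ) : Prop := t.testBit (Nat.pair 0 (Nat.pair x c)) = true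

/-- The neighbourhood relation given by a bitmask. -/
def maskE (t x j : ℕ) : Prop := t.testBit (Nat.pair 1 (Nat.pair x j)) = true

/-- The truth table at templates given by a bitmask. -/
def maskB (t x j c : ℕ) : Prop := t.testBit (Nat.pair 2 (Nat.pair (Nat.pair x j) c)) = true

/-- A bound on the indices used in a table for a model with `m` worlds. -/
def tableBound (m k : ℕ) : ℕ :=
  Nat.pair 2 (Nat.pair (Nat.pair m (2 ^ m)) (k + 1 + 2 ^ m))

theorem exists_modelTable {W : Type u} {m k : ℕ} (e : W ≃ Fin m) (F : Frame W)
    (σ : Assignment W) : ∃ t < 2 ^ tableBound m k, IsModelTable m k (maskA t) (maskE t) (maskB t) ∧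
      ∀ (α : Fml .n), α.code ≤ k → ∀ x, maskA t (e x) α.code ↔ Sat F σ α x := by
  obtain ⟨t, ht, h⟩ := exists_bitmask (tableBound m k) fun i =>
    (∃ (x : W) (α : Fml .n), Nat.pair 0 (Nat.pair (e x) α.code) = i ∧ Sat F σ α x) ∨
    (∃ (x : W) (j : ℕ), Nat.pair 1 (Nat.pair (e x) j) = i ∧ maskSet e j ∈ F.nest x) ∨
    ∃ (x : W) (j : ℕ) (α : Fml .w) (h : maskSet e j ∈ F.nest x),
      Nat.pair 2 (Nat.pair (Nat.pair (e x) j) α.code) = i ∧ Sat F σ α ⟨x, maskSet e j, h⟩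
  have hm := Nat.two_pow_pos m
  have inj : ∀ x y, (e x : ℕ) = e y ↔ x = y := fun x y => by
    rw [← Fin.ext_iff, e.apply_eq_iff_eq]
  have hA : ∀ (α : Fml .n), α.code ≤ k → ∀ x, maskA t (e x) α.code ↔ Sat F σ α x := by
    intro α hα x
    refine (h _ ((Nat.pair_lt_pair_left _ two_pos).trans_le (pair_le_pair le_rfl
      (pair_le_pair ((e x).2.le.trans (Nat.left_le_pair _ _)) (by omega))))).trans ?_
    simp [Nat.pair_eq_pair, inj, Fml.code_injective.eq_iff]
  refine ⟨t, ht, isModelTable_of_frame e F σ hA (fun x j hj => ?_) fun α hα x j hj hS => ?_, hA⟩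
  · refine (h _ ((Nat.pair_lt_pair_left _ one_lt_two).trans_le (pair_le_pair le_rfl
      (pair_le_pair ((e x).2.le.trans (Nat.left_le_pair _ _)) (by omega))))).trans ?_
    simp [Nat.pair_eq_pair, inj]
  · refine (h _ (Nat.pair_lt_pair_right _ ((Nat.pair_lt_pair_right _ (by omega)).trans_le
      (pair_le_pair (pair_le_pair (e x).2.le hj.le) (le_refl (k + 1 + 2 ^ m)))))).trans ?_
    simp only [Nat.pair_eq_pair, inj, Fml.code_injective.eq_iff]
    simp [hS]

theorem valid_iff_table (φ : Fml .n) : Valid.{u} φ ↔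
    ¬ ∃ t < 2 ^ tableBound (worldBound φ.code) φ.code,
      IsModelTable (worldBound φ.code) φ.code (maskA t) (maskE t) (maskB t) ∧
      ∃ x < worldBound φ.code, ¬ maskA t x φ.code := by
  constructor
  · rintro h ⟨t, -, ht, x, hx, hn⟩
    -- The finite model is lifted to universe `u`, where validity is tested; in the other direction
    -- the filtration already lands in `Type`.
    obtain ⟨F, σ, hs⟩ := ht.exists_frame (W := ULift.{u} (Fin (worldBound φ.code))) Equiv.ulift
    exact hn ((hs φ le_rfl ⟨x, hx⟩).1 (h _ F σ _))
  · intro h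
    by_contra hn
    obtain ⟨W, e, F, σ, x, hx⟩ := exists_finite_countermodel le_rfl hn
    obtain ⟨t, ht, htab, hA⟩ := exists_modelTable (k := φ.code) e F σ
    exact h ⟨t, ht, htab, e x, (e x).2, (not_congr (hA φ le_rfl x)).2 hx⟩

theorem primrecPred_modelTable : PrimrecPred fun k : ℕ =>
    ∃ t < 2 ^ tableBound (worldBound k) k,
      IsModelTable (worldBound k) k (maskA t) (maskE t) (maskB t) ∧
      ∃ x < worldBound k, ¬ maskA t x k := by
  simp only [IsModelTable, BoolTable, MaskSub, maskA, maskE, maskB, tableBound, worldBound]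
  repeat' with_reducible first
    | exact Primrec.const _
    | exact primrec_self
    | apply primrecPred_forall_lt
    | apply primrecPred_exists_lt
    | apply PrimrecPred.and
    | apply PrimrecPred.or
    | apply primrecPred_testBit
    | apply primrecPred_isCode
    | apply primrecPred_le
    | apply primrecPred_iff
    | apply PrimrecPred.not
    | apply primrecPred_imp
    | apply primrec_pair
    | apply primrec_add
    | apply primrec_mul
    | apply primrec_pow
    | apply primrec_fst
    | apply primrec_snd

/-- A template is a model with one of its neighbourhoods, which is exactly what `⊛` ranges over. -/
theorem valid_byN_all_iff (φ : Fml .w) : Valid.{u} (.byN .all φ) ↔ Valid.{u} φ :=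
  ⟨fun h W F σ x => h W F σ x.ref x.nbhd x.mem, fun h W F σ _ _ _ => h W F σ _⟩

end PUC

theorem mainTheorem4 :
    PUC.DecidableSet (s := .n) PUC.Provable ∧
    PUC.DecidableSet (s := .n) PUC.Valid.{u} ∧
    PUC.DecidableSet (s := .w) PUC.Valid.{u} :=
  ⟨PUC.decidableSet_of_primrecPred PUC.primrecPred_depthTable PUC.provable_iff_table,
    PUC.decidableSet_of_primrecPred PUC.primrecPred_modelTable PUC.valid_iff_table,
    PUC.decidableSet_of_primrecPred
      -- The composed function sends the code of `φ` to that of `φ^⊛`: tag `10`, label code `0`.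
      (PUC.primrecPred_modelTable.comp (Primrec₂.natPair.comp (.const 10)
        (Primrec₂.natPair.comp (.const 0) .id)))
      fun φ => (PUC.valid_byN_all_iff φ).symm.trans (PUC.valid_iff_table _)⟩
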